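/- **Setting.** Fix $\epsilon\in(0,1]$, $v>0$, an integer $T\ge 2$ and put $\gamma=2/T^3$. Let $\mathcal H_{\epsilon,v}$ be the set of probability laws on $\mathbb R$ with finite mean $\mu$ and $\mathbb E|X-\mu|^{1+\epsilon}\le v$. Let $\phi_\epsilon(x)=\operatorname{sign}(x)\log\bigl(1+|x|+\tfrac{|x|^{1+\epsilon}}{1+\epsilon}\bigr)$. For $n\ge1$ let $j=j(n)=\max\{1,\lceil\log n\rceil-1\}$ (so that $e^{j}<n\le e^{j+1}$ when $n>e$, $j=1$ including also all $n\le e$), $\gamma_j=\gamma/(j+1)^2$, $\Lambda_j=\bigl(\log(2/\gamma_j)\,e^{-j}/v\bigr)^{1/(1+\epsilon)}$. The stitched Catoni set of $n$ observations $x_1,\dots,x_n$, whose weights $\lambda_1=\dots=\lambda_n=\Lambda_j$ are deterministic (hence predictable), is $$\mathrm{CI}_n(x_1,\dots,x_n)=\Bigl\{m\in\mathbb R:\ \Bigl|\sum_{i=1}^n\phi_\epsilon(\Lambda_j(x_i-m))\Bigr|\le \frac{v}{1+\epsilon}\,n\Lambda_j^{1+\epsilon}+\log\frac{2}{\gamma_j}\Bigr\}.$$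 The width of a set $S\subseteq\mathbb R$ is $\sup_{m_1,m_2\in S}|m_1-m_2|$. The Catoni-FCS-detector on a stream $X_1,X_2,\dots$ starts a new sequence of these sets at every round $a\ge 1$ and stops at the first round at which all sets computed so far have no common point: $$\tau=\inf\Bigl\{t:\ \bigcap_{a=1}^{t}\bigcap_{s=a}^{t}\mathrm{CI}_{s-a+1}(X_a,\dots,X_s)=\emptyset\Bigr\}\in\mathbb N\cup\{\infty\}.$$ Let $n_{\min}=68\log\bigl(T^{(1+\epsilon)/\epsilon}\bigr)$. **Statement.** For every $\epsilon\in(0,1]$ there is a constant $C>0$, depending only on $\epsilon$, such that the following holds for all $v>0$, all integers $T\ge 2$ and $\gamma=2/T^3$. *Confidence sequence.* If $Y_1,Y_2,\dots$ are i.i.d. with law in $\mathcal H_{\epsilon,v}$ and mean $\mu$, then $\mathbb P(\forall n\ge1:\ \mu\in \mathrm{CI}_n(Y_1,\dots,Y_n))\ge 1-\gamma$, and for every $n\ge n_{\min}$, with probability at least $1-\gamma/4$, the width of $\mathrm{CI}_n(Y_1,\dots,Y_n)$ is at most $$C\,v^{\frac1{1+\epsilon}}\Bigl(\frac{\log(2/\gamma)+2\log\log(e^2n)}{n}\Bigr)^{\frac{\epsilon}{1+\epsilon}}.$$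 *Detection.* Let $X_1,X_2,\dots$ be independent, with law $P_0\in\mathcal H_{\epsilon,v}$ of mean $\mu_0$ for $t\le t_c$ and law $P_1\in\mathcal H_{\epsilon,v}$ of mean $\mu_1$ for $t>t_c$, where $1\le t_c\le T$; let $\delta=|\mu_1-\mu_0|$. Suppose that $t_c\ge n_{\min}$ and that $t_c$ is large enough for the pre-change width to be at most $\delta/2$, i.e. the width of $\mathrm{CI}_{t_c}(X_1,\dots,X_{t_c})$ is at most $\delta/2$ with probability at least $1-\gamma/4$. Then (i) $\displaystyle \mathbb P\Bigl((\tau-t_c)^+\le C\,\max\Bigl\{1,\frac{v^{1/\epsilon}}{\delta^{(1+\epsilon)/\epsilon}}\Bigr\}\log T\Bigr)\ge 1-\frac{14}{T}$; in particular, for $\delta\le v^{1/(1+\epsilon)}$, the delay is at most $C\,v^{1/\epsilon}\log T/\delta^{(1+\epsilon)/\epsilon}$ with this probability; (ii) $\displaystyle \mathbb P(\tau<t_c)\le\frac{14}{T}$. -/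

import Mathlib

open MeasureTheory ProbabilityTheory
open scoped ENNReal

noncomputable section

namespace CatoniFCS

/-- The class of heavy-tailed laws: a finite mean and a centred absolute moment of
order `1 + ε` that is at most `v`. -/
def HeavyTailed (ε v : ℝ) (ν : Measure ℝ) : Prop :=
  Integrable (fun x : ℝ => x) ν ∧
    ∫⁻ x, ENNReal.ofReal (|x - ∫ y, y ∂ν| ^ (1 + ε)) ∂ν ≤ ENNReal.ofReal v

/-- `Y 0, Y 1, …` are independent with common law `ν`. -/
structure IsIIDStream {Ω : Type*} [MeasurableSpace Ω] (P : Measure Ω) (Y : ℕ → Ω → ℝ)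
    (ν : Measure ℝ) : Prop where
  measurable : ∀ i, Measurable (Y i)
  indep : iIndepFun Y P
  law : ∀ i, P.map (Y i) = ν

/-- Independent observations `X 1, X 2, …`, with law `P₀` up to and including round `tc`
and law `P₁` afterwards (`X 0` plays no role). -/
structure IsChangeStream {Ω : Type*} [MeasurableSpace Ω] (P : Measure Ω) (X : ℕ → Ω → ℝ)
    (P₀ P₁ : Measure ℝ) (tc : ℕ) : Prop where
  measurable : ∀ t, Measurable (X t)
  indep : iIndepFun X P
  law_pre : ∀ t, 1 ≤ t → t ≤ tc → P.map (X t) = P₀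
  law_post : ∀ t, tc < t → P.map (X t) = P₁

/-- The (odd) Catoni-type influence function. -/
def influence (ε x : ℝ) : ℝ :=
  Real.sign x * Real.log (1 + |x| + |x| ^ (1 + ε) / (1 + ε))

/-- The Catoni confidence set computed from the `n` observations `x 0, …, x (n - 1)`, with
weights `lam 0, …, lam (n - 1)` and level `γ`. -/
def catoniCI (ε v : ℝ) (lam : ℕ → ℝ) (γ : ℝ) (x : ℕ → ℝ) (n : ℕ) : Set ℝ :=
  {m : ℝ |
    -(v / (1 + ε) * ∑ i ∈ Finset.range n, lam i ^ (1 + ε)) - Real.log (2 / γ)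
        ≤ ∑ i ∈ Finset.range n, influence ε (lam i * (x i - m)) ∧
    ∑ i ∈ Finset.range n, influence ε (lam i * (x i - m))
        ≤ v / (1 + ε) * ∑ i ∈ Finset.range n, lam i ^ (1 + ε) + Real.log (2 / γ)}

/-- The cell of the exponential grid that contains `n`: the `j` with `e ^ j < n ≤ e ^ (j + 1)`,
where the first cell is `j = 1` and also takes the sizes `n ≤ e`. -/
def cell (n : ℕ) : ℕ := max 1 (⌈Real.log n⌉₊ - 1)

/-- The level used in cell `j`. -/
def cellLevel (γ : ℝ) (j : ℕ) : ℝ := γ / ((j : ℝ) + 1) ^ 2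

/-- The weight used in cell `j`: `(log (2 / γ_j) * e ^ (-j) / v) ^ (1 / (1 + ε))`. -/
def cellWeight (ε v γ : ℝ) (j : ℕ) : ℝ :=
  (Real.log (2 / cellLevel γ j) * Real.exp (-(j : ℝ)) / v) ^ (1 / (1 + ε))

/-- The stitched Catoni confidence set: the Catoni set of size `n` in which all weights and the
level are those of the cell of `n`. The weights are deterministic, hence predictable. -/
def stitchedCI (ε v γ : ℝ) (x : ℕ → ℝ) (n : ℕ) : Set ℝ :=
  catoniCI ε v (fun _ => cellWeight ε v γ (cell n)) (cellLevel γ (cell n)) x n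

/-- The width of `S` is at most `w`. -/
def WidthLE (S : Set ℝ) (w : ℝ) : Prop := ∀ m₁ ∈ S, ∀ m₂ ∈ S, |m₁ - m₂| ≤ w

/-- The repeated-FCS-detector built on the rule `CI` has an empty intersection at round `t`.
A new sequence of confidence sets is started at every round `a ≥ 1`, from the observations
`x a, x (a + 1), …`; by round `t` it consists of its sets of sizes `n = 1, …, t + 1 - a`. -/
def FCSAlarm (CI : (ℕ → ℝ) → ℕ → Set ℝ) (x : ℕ → ℝ) (t : ℕ) : Prop :=
  {m : ℝ | ∀ a n : ℕ, 1 ≤ a → 1 ≤ n → a + n ≤ t + 1 → m ∈ CI (fun i => x (a + i)) n} = ∅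

/-- The detection time of the repeated-FCS-detector: the first round at which the intersection
is empty, `⊤` if there is none. -/
def detectionTime (CI : (ℕ → ℝ) → ℕ → Set ℝ) (x : ℕ → ℝ) : ℕ∞ :=
  ⨅ t : {t : ℕ // FCSAlarm CI x t}, ((t : ℕ) : ℕ∞)

/-- The detection time of the Catoni-FCS-detector with stitched weights. -/
def catoniDetectionTime (ε v γ : ℝ) (x : ℕ → ℝ) : ℕ∞ :=
  detectionTime (stitchedCI ε v γ) x

/-- The least number of samples `68 log (T ^ ((1 + ε) / ε))`. -/
def nMin (ε : ℝ) (T : ℕ) : ℝ := 68 * Real.log ((T : ℝ) ^ ((1 + ε) / ε))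

end CatoniFCS

end

/-
The stitched Catoni confidence sequence and the delay of the repeated-FCS-detector built on it.
The time-uniform bounds come from Ville's inequality for products of independent variables.
-/

/-! Write $U=\lambda(X-\mu)$ and $A=v\lambda^{1+\epsilon}$. Everything rests on two exponential
moments of the influence function. At the mean, $e^{\phi(x)}\le 1+x+|x|^{1+\epsilon}/(1+\epsilon)$
(`exp_influence_le`) and centring give $\mathbb E e^{\phi(\pm U)}\le e^{A/(1+\epsilon)}$. Away from
the mean, a shift $z$ of order $A$ gives $\mathbb E e^{\phi(\pm U-z)}\le e^{-3A}$ as soon as $A\le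
1/4$ (`lintegral_exp_influence_sub_shift_le`).

Coverage: within one cell the weight is constant, so Ville's inequality controls all sample sizes at
once with error $\gamma_j$, and $\sum_j\gamma_j\le\gamma$.

Width: the influence sum decreases in $m$, so it suffices to test it at $\mu\pm z/\lambda$. There
the drift $-3nA$ pays for the acceptance radius $nA/(1+\epsilon)+\log(2/\gamma_j)$ and for the
deviation $\log(8/\gamma)$, because $\log(2/\gamma_j)=Ae^j\le nA$. The width is thus at most
$2z/\lambda$, of order $A/\lambda=v^{1/(1+\epsilon)}A^{\epsilon/(1+\epsilon)}$.

Detection: an alarm before $t_c$ forces one of at most $t_c$ pre-change runs to miss $\mu_0$, which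
costs $t_c\gamma$. For the delay, the run started at round 1 is read at size $t_c$ and the run
started at $t_c+1$ at size $n$. Both contain their means, and their widths add up to less than
$\delta$, so they are disjoint. The subtle point is that $\log\log n$ must be $O(\log T)$ uniformly
in $v$ and $\delta$. The width also has a deterministic lower bound (`le_of_widthLE`), so the width
hypothesis at $t_c\le T$ keeps the delay scale polynomial in $T$ (`delayScale_le_of_widthLE`). -/

namespace CatoniFCS

/-! ### Pointwise bounds on the influence function. -/

section Influence

variable {ε : ℝ}

/-- The argument of the logarithm in the influence function, on the half-line `0 ≤ y`. -/
noncomputable def majorant (ε y : ℝ) : ℝ := 1 + y + y ^ (1 + ε) / (1 + ε)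

lemma one_le_majorant (hε : 0 < ε) {y : ℝ} (hy : 0 ≤ y) : 1 ≤ majorant ε y := by
  have : 0 ≤ y ^ (1 + ε) / (1 + ε) := by positivity
  unfold majorant; linarith

lemma majorant_mono (hε : 0 < ε) {x y : ℝ} (hx : 0 ≤ x) (hxy : x ≤ y) :
    majorant ε x ≤ majorant ε y := by
  have : x ^ (1 + ε) / (1 + ε) ≤ y ^ (1 + ε) / (1 + ε) := by gcongr
  unfold majorant; linarith

lemma influence_of_nonneg (hε : 0 < ε) {x : ℝ} (hx : 0 ≤ x) :
    influence ε x = Real.log (majorant ε x) := by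
  unfold influence majorant
  rcases hx.eq_or_lt with rfl | h
  · simp [Real.zero_rpow (by linarith : (1 + ε) ≠ 0)]
  · rw [Real.sign_of_pos h, abs_of_pos h, one_mul]

lemma influence_neg (x : ℝ) : influence ε (-x) = -influence ε x := by
  unfold influence
  rw [abs_neg, Real.sign_neg, neg_mul]

lemma influence_of_nonpos (hε : 0 < ε) {x : ℝ} (hx : x ≤ 0) :
    influence ε x = -Real.log (majorant ε (-x)) := by
  rw [← influence_of_nonneg hε (by linarith), influence_neg, neg_neg]

lemma influence_nonneg (hε : 0 < ε) {x : ℝ} (hx : 0 ≤ x) : 0 ≤ influence ε x := by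
  rw [influence_of_nonneg hε hx]
  exact Real.log_nonneg (one_le_majorant hε hx)

lemma influence_nonpos (hε : 0 < ε) {x : ℝ} (hx : x ≤ 0) : influence ε x ≤ 0 := by
  have := influence_nonneg hε (neg_nonneg.2 hx)
  rw [influence_neg] at this; linarith

lemma log_majorant_mono (hε : 0 < ε) {x y : ℝ} (hx : 0 ≤ x) (hxy : x ≤ y) :
    Real.log (majorant ε x) ≤ Real.log (majorant ε y) :=
  Real.log_le_log (by linarith [one_le_majorant hε hx]) (majorant_mono hε hx hxy)

lemma influence_mono (hε : 0 < ε) : Monotone (influence ε) := by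
  intro x y hxy
  rcases le_total 0 x with hx | hx
  · rw [influence_of_nonneg hε hx, influence_of_nonneg hε (hx.trans hxy)]
    exact log_majorant_mono hε hx hxy
  · rcases le_total 0 y with hy | hy
    · exact (influence_nonpos hε hx).trans (influence_nonneg hε hy)
    · rw [influence_of_nonpos hε hx, influence_of_nonpos hε hy]
      exact neg_le_neg (log_majorant_mono hε (by linarith) (by linarith))

lemma rpow_le_one_add (hε : 0 < ε) (hε₁ : ε ≤ 1) {y : ℝ} (hy : 0 ≤ y) : y ^ ε ≤ 1 + y := by
  rcases le_total y 1 with h | h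
  · linarith [Real.rpow_le_one hy h hε.le]
  · have := Real.rpow_le_rpow_of_exponent_le h hε₁
    rw [Real.rpow_one] at this; linarith

/-- The derivative is $(1+z^\epsilon)/(1+z+\dots)$, at most 2 because $z^\epsilon\le 1+z$. The
resulting Lipschitz constant drives the lower bound on the width. -/
lemma log_majorant_sub_le (hε : 0 < ε) (hε₁ : ε ≤ 1) {x y : ℝ} (hx : 0 ≤ x) (hxy : x ≤ y) :
    Real.log (majorant ε y) - Real.log (majorant ε x) ≤ 2 * (y - x) := by
  have hd : ∀ z : ℝ, 0 ≤ z → HasDerivAt (fun z => Real.log (majorant ε z))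
      ((1 + z ^ ε) / majorant ε z) z := by
    intro z hz
    have h1 : HasDerivAt (majorant ε) (0 + 1 + ((1 + ε) * z ^ (1 + ε - 1)) / (1 + ε)) z :=
      ((hasDerivAt_const z (1 : ℝ)).add (hasDerivAt_id z)).add
        ((Real.hasDerivAt_rpow_const (Or.inr (by linarith))).div_const _)
    have h2 := h1.log (by linarith [one_le_majorant hε hz])
    convert h2 using 2
    have : (1 + ε) ≠ 0 := by linarith
    field_simp
    ring_nf
  refine (convex_Ici (0 : ℝ)).image_sub_le_mul_sub_of_deriv_le
    (f := fun z => Real.log (majorant ε z))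
    (fun z hz => (hd z hz).continuousAt.continuousWithinAt)
    (fun z hz => (hd z (interior_subset hz)).differentiableAt.differentiableWithinAt)
    (fun z hz => ?_) x hx y (hx.trans hxy) hxy
  have hz0 : 0 ≤ z := interior_subset hz
  rw [(hd z hz0).deriv, div_le_iff₀ (by linarith [one_le_majorant hε hz0])]
  have h1 := rpow_le_one_add hε hε₁ hz0
  have h2 : 0 ≤ z ^ (1 + ε) / (1 + ε) := by positivity
  unfold majorant
  linarith

lemma influence_sub_le (hε : 0 < ε) (hε₁ : ε ≤ 1) {x y : ℝ} (hxy : x ≤ y) :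
    influence ε y - influence ε x ≤ 2 * (y - x) := by
  have h0 : Real.log (majorant ε 0) = 0 := by
    simp [majorant, Real.zero_rpow (by linarith : (1 + ε) ≠ 0)]
  rcases le_total 0 x with hx | hx
  · rw [influence_of_nonneg hε hx, influence_of_nonneg hε (hx.trans hxy)]
    exact log_majorant_sub_le hε hε₁ hx hxy
  · rcases le_total 0 y with hy | hy
    · rw [influence_of_nonpos hε hx, influence_of_nonneg hε hy]
      have h1 := log_majorant_sub_le hε hε₁ le_rfl hy
      have h2 := log_majorant_sub_le hε hε₁ le_rfl (neg_nonneg.2 hx)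
      linarith
    · rw [influence_of_nonpos hε hx, influence_of_nonpos hε hy]
      have := log_majorant_sub_le hε hε₁ (neg_nonneg.2 hy) (neg_le_neg hxy)
      linarith

lemma continuous_influence (hε : 0 < ε) (hε₁ : ε ≤ 1) : Continuous (influence ε) := by
  refine (LipschitzWith.of_dist_le_mul (K := 2) fun x y => ?_).continuous
  rw [Real.dist_eq, Real.dist_eq]
  rcases le_total x y with h | h
  · rw [abs_sub_comm, abs_of_nonneg (sub_nonneg.2 (influence_mono hε h)), abs_sub_comm,
      abs_of_nonneg (sub_nonneg.2 h)]
    exact influence_sub_le hε hε₁ h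
  · rw [abs_of_nonneg (sub_nonneg.2 (influence_mono hε h)), abs_of_nonneg (sub_nonneg.2 h)]
    exact influence_sub_le hε hε₁ h

/-- For $x=-y\le 0$ the bound on $e^{\phi(x)}$ says $(1+y^p/p+y)(1+y^p/p-y)\ge 1$ with
$p=1+\epsilon$, and a difference of squares turns it into this inequality. -/
lemma one_add_sq_le_sq (hε : 0 < ε) (hε₁ : ε ≤ 1) {y : ℝ} (hy : 0 ≤ y) :
    1 + y ^ 2 ≤ (1 + y ^ (1 + ε) / (1 + ε)) ^ 2 := by
  set p := 1 + ε with hp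
  have hp0 : 0 < p := by linarith
  set u := y ^ p with hu
  have hu0 : 0 ≤ u := by positivity
  -- The weights make the geometric mean of $u=y^p$ and $u^2$ equal to $y^2$. They are nonnegative
  -- since $1\le p\le 2$, and they are dominated by the coefficients $2/p$ and $1/p^2$ of the
  -- expanded square.
  have key := Real.geom_mean_le_arith_mean2_weighted (w₁ := 2 - 2 / p) (w₂ := 2 / p - 1)
    (p₁ := u) (p₂ := u ^ 2)
    (by rw [sub_nonneg, div_le_iff₀ hp0]; linarith)
    (by rw [sub_nonneg, le_div_iff₀ hp0]; linarith) hu0 (by positivity) (by ring)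
  have hy2 : u ^ (2 - 2 / p) * (u ^ 2) ^ (2 / p - 1) = y ^ 2 := by
    rcases hy.eq_or_lt with rfl | hy'
    · have hu' : u = 0 := by rw [hu, Real.zero_rpow hp0.ne']
      rw [hu']
      rw [Real.zero_rpow]
      · simp
      · intro h
        have : p = 1 := by field_simp at h; linarith
        linarith
    · have : (u ^ 2) = y ^ (2 * p) := by rw [hu, ← Real.rpow_natCast, ← Real.rpow_mul hy]; ring_nf
      rw [this, hu, ← Real.rpow_mul hy, ← Real.rpow_mul hy, ← Real.rpow_add hy',
        ← Real.rpow_natCast]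
      congr 1
      push_cast
      field_simp
      ring
  rw [hy2] at key
  have h1 : (2 - 2 / p) * u ≤ 2 / p * u := by
    gcongr
    have : 1 ≤ 2 / p := by rw [le_div_iff₀ hp0]; linarith
    linarith
  have h2 : (2 / p - 1) * u ^ 2 ≤ (1 / p) ^ 2 * u ^ 2 := by
    gcongr
    have h3 := sq_nonneg (1 - 1 / p)
    have h4 : 2 / p = 2 * (1 / p) := by ring
    rw [h4]; nlinarith
  calc 1 + y ^ 2 ≤ 1 + (2 / p * u + (1 / p) ^ 2 * u ^ 2) := by linarith
    _ = _ := by ring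

/-- The bound that makes the exponential of the influence function integrable. -/
lemma exp_influence_le (hε : 0 < ε) (hε₁ : ε ≤ 1) (x : ℝ) :
    Real.exp (influence ε x) ≤ 1 + x + |x| ^ (1 + ε) / (1 + ε) := by
  rcases le_total 0 x with hx | hx
  · rw [influence_of_nonneg hε hx, Real.exp_log (by linarith [one_le_majorant hε hx]),
      abs_of_nonneg hx, majorant]
  · have hx' := neg_nonneg.2 hx
    have h1 := one_le_majorant hε hx'
    rw [influence_of_nonpos hε hx, Real.exp_neg, Real.exp_log (by linarith), abs_of_nonpos hx,
      inv_le_iff_one_le_mul₀ (by linarith)]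
    have h2 := one_add_sq_le_sq hε hε₁ hx'
    unfold majorant
    nlinarith

lemma exp_influence_le_abs (hε : 0 < ε) (x y : ℝ) (hxy : x ≤ |y|) :
    Real.exp (influence ε x) ≤ 1 + |y| + |y| ^ (1 + ε) / (1 + ε) := by
  calc Real.exp (influence ε x) ≤ Real.exp (influence ε |y|) :=
        Real.exp_le_exp.2 (influence_mono hε hxy)
    _ = _ := by
        rw [influence_of_nonneg hε (abs_nonneg _),
          Real.exp_log (by linarith [one_le_majorant hε (abs_nonneg y)]), majorant]

lemma two_rpow_le (hε : 0 < ε) (hε₁ : ε ≤ 1) : (2 : ℝ) ^ ε ≤ 1 + ε := by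
  have := rpow_one_add_le_one_add_mul_self (s := 1) (by norm_num) hε.le hε₁
  rw [mul_one] at this
  convert this using 2
  norm_num

lemma abs_sub_rpow_le (hε : 0 < ε) (u : ℝ) {z : ℝ} (hz : 0 ≤ z) :
    |u - z| ^ (1 + ε) ≤ 2 ^ ε * (|u| ^ (1 + ε) + z ^ (1 + ε)) := by
  have h := NNReal.rpow_add_le_mul_rpow_add_rpow ⟨|u|, abs_nonneg u⟩ ⟨z, hz⟩
    (p := 1 + ε) (by linarith)
  have h' : (|u| + z) ^ (1 + ε) ≤ 2 ^ (1 + ε - 1) * (|u| ^ (1 + ε) + z ^ (1 + ε)) := by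
    exact_mod_cast h
  rw [add_sub_cancel_left] at h'
  refine le_trans ?_ h'
  gcongr
  calc |u - z| ≤ |u| + |z| := abs_sub _ _
    _ = _ := by rw [abs_of_nonneg hz]

/-- The exponential of a shifted influence function, for small shifts. -/
lemma exp_influence_sub_le (hε : 0 < ε) (hε₁ : ε ≤ 1) (u : ℝ) {z : ℝ} (hz : 0 ≤ z) :
    Real.exp (influence ε (u - z)) ≤ 1 + (u - z) + (|u| ^ (1 + ε) + z ^ (1 + ε)) := by
  refine (exp_influence_le hε hε₁ _).trans ?_
  -- The convexity factor $2^\epsilon\le 1+\epsilon$ is absorbed by the denominator $1+\epsilon$.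
  have h1 := abs_sub_rpow_le hε u hz
  have h2 : 2 ^ ε * (|u| ^ (1 + ε) + z ^ (1 + ε)) ≤ (1 + ε) * (|u| ^ (1 + ε) + z ^ (1 + ε)) := by
    gcongr
    exact two_rpow_le hε hε₁
  have : |u - z| ^ (1 + ε) / (1 + ε) ≤ |u| ^ (1 + ε) + z ^ (1 + ε) := by
    rw [div_le_iff₀ (by linarith)]; linarith
  linarith

/-- The exponential of a shifted influence function, for large shifts. -/
lemma exp_influence_sub_large_le (hε : 0 < ε) (hε₁ : ε ≤ 1) (u : ℝ) :
    Real.exp (influence ε (u - 2 * 16 ^ (1 / ε))) ≤ 1 / 8 + 9 / 8 * |u| ^ (1 + ε) := by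
  set r : ℝ := 16 ^ (1 / ε) with hr
  have hr0 : 0 < r := by positivity
  have hr1 : 1 ≤ r := Real.one_le_rpow (by norm_num) (by positivity)
  have hrε : r ^ ε = 16 := by
    rw [hr, ← Real.rpow_mul (by norm_num), one_div_mul_cancel hε.ne', Real.rpow_one]
  have hrp : 16 ≤ r ^ (1 + ε) := by
    rw [Real.rpow_add hr0, Real.rpow_one, hrε]; linarith
  have hup : 0 ≤ |u| ^ (1 + ε) := by positivity
  -- If $|u|\le r$, the argument is at most $-r$ and the exponential at most $1/8$. Otherwise
  -- $|u|^\epsilon\ge 16$, so $1+|u|\le 2|u|\le |u|^{1+\epsilon}/8$.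
  rcases le_total |u| r with h | h
  · have h1 : influence ε (u - 2 * r) ≤ influence ε (-r) :=
      influence_mono hε (by linarith [le_abs_self u])
    have h2 : 8 ≤ majorant ε r := by
      have : 8 ≤ r ^ (1 + ε) / (1 + ε) := by rw [le_div_iff₀ (by linarith)]; linarith
      unfold majorant; linarith
    have h3 : Real.exp (influence ε (-r)) ≤ 1 / 8 := by
      rw [influence_neg, influence_of_nonneg hε hr0.le, Real.exp_neg, Real.exp_log (by linarith),
        ← one_div]
      gcongr
    have := Real.exp_le_exp.2 h1
    linarith
  · have h0 : 0 < |u| := by linarith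
    have h1 := exp_influence_le_abs hε (u - 2 * r) u (by linarith [le_abs_self u])
    have h2 : 16 ≤ |u| ^ ε := by rw [← hrε]; gcongr
    have h3 : |u| ^ (1 + ε) = |u| * |u| ^ ε := by rw [Real.rpow_add h0, Real.rpow_one]
    have h4 : 16 * |u| ≤ |u| ^ (1 + ε) := by rw [h3]; nlinarith
    have h5 : |u| ^ (1 + ε) / (1 + ε) ≤ |u| ^ (1 + ε) := div_le_self hup (by linarith)
    linarith

end Influence

/-! ### Exponential moments of the influence function. -/

section Moments

variable {ε : ℝ}

/-- A shift at which the exponential moment of the influence function, for a centred variable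
whose moment of order `1 + ε` is at most `A`, is at most `exp (-3 A)`. -/
noncomputable def shift (ε A : ℝ) : ℝ := if (9 * A) ^ ε ≤ 1 / 2 then 9 * A else 2 * 16 ^ (1 / ε)

/-- The constant shift is used only when $9A\cdot 2^{1/\epsilon}\ge 1$, so it is still linear in
$A$, at the price of a factor depending on $\epsilon$. -/
lemma shift_le (hε : 0 < ε) {A : ℝ} (hA : 0 < A) : shift ε A ≤ 18 * 32 ^ (1 / ε) * A := by
  have h32 : (32 : ℝ) ^ (1 / ε) = 16 ^ (1 / ε) * 2 ^ (1 / ε) := by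
    rw [← Real.mul_rpow (by norm_num) (by norm_num)]; norm_num
  unfold shift; split_ifs with h
  · have : (1 : ℝ) ≤ 32 ^ (1 / ε) := Real.one_le_rpow (by norm_num) (by positivity)
    nlinarith
  · have h1 : 1 ≤ 9 * A * 2 ^ (1 / ε) := by
      by_contra! hlt
      apply h
      have h2 : (9 * A * 2 ^ (1 / ε)) ^ ε ≤ 1 := Real.rpow_le_one (by positivity) hlt.le hε.le
      rw [Real.mul_rpow (by positivity) (by positivity), ← Real.rpow_mul (by norm_num),
        one_div_mul_cancel hε.ne', Real.rpow_one] at h2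
      linarith
    rw [h32]
    have : (0 : ℝ) < 16 ^ (1 / ε) := by positivity
    nlinarith

variable {Ω : Type*} [MeasurableSpace Ω] {P : Measure Ω} [IsProbabilityMeasure P] {U : Ω → ℝ}
  {A : ℝ}

lemma lintegral_ofReal_le_of_le (hUm : Measurable U) (hU : Integrable U P) (hU0 : ∫ ω, U ω ∂P = 0)
    (hUA : ∫⁻ ω, ENNReal.ofReal (|U ω| ^ (1 + ε)) ∂P ≤ ENNReal.ofReal A) (hA : 0 ≤ A)
    {F : Ω → ℝ} {a b c : ℝ} (hc : 0 ≤ c) (hF0 : ∀ ω, 0 ≤ F ω)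
    (hF : ∀ ω, F ω ≤ a + b * U ω + c * |U ω| ^ (1 + ε)) :
    ∫⁻ ω, ENNReal.ofReal (F ω) ∂P ≤ ENNReal.ofReal (a + c * A) := by
  have hm : Measurable fun ω => |U ω| ^ (1 + ε) := by fun_prop
  have hi : Integrable (fun ω => |U ω| ^ (1 + ε)) P := by
    refine ⟨hm.aestronglyMeasurable, ?_⟩
    rw [hasFiniteIntegral_iff_ofReal (ae_of_all _ fun ω => by positivity)]
    exact hUA.trans_lt ENNReal.ofReal_lt_top
  have hle : ∫ ω, |U ω| ^ (1 + ε) ∂P ≤ A := by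
    rw [integral_eq_lintegral_of_nonneg_ae (ae_of_all _ fun ω => by positivity)
      hm.aestronglyMeasurable]
    exact ENNReal.toReal_le_of_le_ofReal hA hUA
  have hab : Integrable (fun ω => a + b * U ω) P := (integrable_const a).add (hU.const_mul b)
  calc ∫⁻ ω, ENNReal.ofReal (F ω) ∂P
      ≤ ∫⁻ ω, ENNReal.ofReal (a + b * U ω + c * |U ω| ^ (1 + ε)) ∂P :=
        lintegral_mono fun ω => ENNReal.ofReal_le_ofReal (hF ω)
    _ = ENNReal.ofReal (∫ ω, (a + b * U ω + c * |U ω| ^ (1 + ε)) ∂P) :=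
        (ofReal_integral_eq_lintegral_ofReal (hab.add (hi.const_mul c))
          (ae_of_all _ fun ω => (hF0 ω).trans (hF ω))).symm
    _ ≤ ENNReal.ofReal (a + c * A) := by
        refine ENNReal.ofReal_le_ofReal ?_
        rw [integral_add hab (hi.const_mul c),
          integral_add (integrable_const a) (hU.const_mul b), integral_const_mul,
          integral_const_mul, hU0]
        simp only [integral_const, probReal_univ, smul_eq_mul]
        nlinarith

lemma lintegral_exp_influence_le (hε : 0 < ε) (hε₁ : ε ≤ 1) (hUm : Measurable U)
    (hU : Integrable U P) (hU0 : ∫ ω, U ω ∂P = 0)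
    (hUA : ∫⁻ ω, ENNReal.ofReal (|U ω| ^ (1 + ε)) ∂P ≤ ENNReal.ofReal A) (hA : 0 ≤ A) :
    ∫⁻ ω, ENNReal.ofReal (Real.exp (influence ε (U ω))) ∂P
      ≤ ENNReal.ofReal (Real.exp (A / (1 + ε))) := by
  refine (lintegral_ofReal_le_of_le hUm hU hU0 hUA hA (a := 1) (b := 1) (c := (1 + ε)⁻¹)
    (by positivity) (fun ω => (Real.exp_pos _).le) fun ω => ?_).trans
      (ENNReal.ofReal_le_ofReal ?_)
  · have := exp_influence_le hε hε₁ (U ω)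
    rw [div_eq_inv_mul] at this
    linarith
  · have := Real.add_one_le_exp (A / (1 + ε))
    rw [← div_eq_inv_mul]; linarith

/-- For $z=9A$ with $z^\epsilon\le 1/2$, the loss $z^{1+\epsilon}+A$ leaves $1-9A+\tfrac92A+A\le
1-3A$. If $z^\epsilon$ is larger, $z^{1+\epsilon}$ could cancel the gain of $z$; the constant shift
then gives at most $\tfrac18+\tfrac98\cdot\tfrac14=\tfrac{13}{32}\le e^{-3/4}$. -/
lemma lintegral_exp_influence_sub_shift_le (hε : 0 < ε) (hε₁ : ε ≤ 1) (hUm : Measurable U)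
    (hU : Integrable U P) (hU0 : ∫ ω, U ω ∂P = 0)
    (hUA : ∫⁻ ω, ENNReal.ofReal (|U ω| ^ (1 + ε)) ∂P ≤ ENNReal.ofReal A) (hA : 0 < A)
    (hA4 : A ≤ 1 / 4) :
    ∫⁻ ω, ENNReal.ofReal (Real.exp (influence ε (U ω - shift ε A))) ∂P
      ≤ ENNReal.ofReal (Real.exp (-(3 * A))) := by
  unfold shift; split_ifs with h
  · refine (lintegral_ofReal_le_of_le hUm hU hU0 hUA hA.le
      (a := 1 - 9 * A + (9 * A) ^ (1 + ε)) (b := 1) (c := 1)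
      (by positivity) (fun ω => (Real.exp_pos _).le) fun ω => ?_).trans
        (ENNReal.ofReal_le_ofReal ?_)
    · have := exp_influence_sub_le hε hε₁ (U ω) (z := 9 * A) (by positivity)
      linarith
    · have h1 := Real.add_one_le_exp (-(3 * A))
      have h2 : (9 * A) ^ (1 + ε) ≤ 9 * A * (1 / 2) := by
        rw [Real.rpow_add (by positivity), Real.rpow_one]; gcongr
      linarith
  · refine (lintegral_ofReal_le_of_le hUm hU hU0 hUA hA.le
      (a := 1 / 8) (b := 0) (c := 9 / 8)
      (by positivity) (fun ω => (Real.exp_pos _).le) fun ω => ?_).trans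
        (ENNReal.ofReal_le_ofReal ?_)
    · have := exp_influence_sub_large_le hε hε₁ (U ω)
      linarith
    · have h1 := Real.add_one_le_exp (-(3 * A))
      have h2 : 13 / 32 ≤ Real.exp (-(3 / 4)) := by
        have h3 := Real.add_one_le_exp (-(3 / 8) : ℝ)
        have h4 : Real.exp (-(3 / 4)) = Real.exp (-(3 / 8)) ^ 2 := by
          rw [← Real.exp_nat_mul]; norm_num
        have h5 : (33 / 50 : ℝ) ≤ Real.exp (-(3 / 8)) := by
          have h6 := Real.add_one_le_exp (-(3 / 32) : ℝ)
          have h7 : Real.exp (-(3 / 8)) = Real.exp (-(3 / 32)) ^ 4 := by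
            rw [← Real.exp_nat_mul]; norm_num
          rw [h7]
          calc (33 / 50 : ℝ) ≤ (29 / 32) ^ 4 := by norm_num
            _ ≤ _ := by gcongr; linarith
        rw [h4]; nlinarith
      have h3 : Real.exp (-(3 / 4)) ≤ Real.exp (-(3 * A)) := Real.exp_le_exp.2 (by linarith)
      linarith

end Moments

/-! ### Ville's inequality by freezing products at a level. -/

section Ville

/-- The partial products of `z`, frozen from the first time at which they reach `c`. -/
noncomputable def stoppedProd (c : ℝ≥0∞) (z : ℕ → ℝ≥0∞) : ℕ → ℝ≥0∞
  | 0 => 1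
  | n + 1 => if c ≤ stoppedProd c z n then stoppedProd c z n else stoppedProd c z n * z n

lemma measurable_stoppedProd (c : ℝ≥0∞) (n : ℕ) :
    Measurable fun z : ℕ → ℝ≥0∞ => stoppedProd c z n := by
  induction n with
  | zero => exact measurable_const
  | succ n ih =>
    exact Measurable.ite (measurableSet_le measurable_const ih) ih (ih.mul (measurable_pi_apply n))

lemma stoppedProd_congr (c : ℝ≥0∞) {z z' : ℕ → ℝ≥0∞} {n : ℕ} (h : ∀ i < n, z i = z' i) :
    stoppedProd c z n = stoppedProd c z' n := by
  induction n with
  | zero => rfl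
  | succ n ih =>
    rw [stoppedProd, stoppedProd, ih fun i hi => h i (hi.trans n.lt_succ_self), h n n.lt_succ_self]

lemma le_stoppedProd_of_le {c : ℝ≥0∞} {z : ℕ → ℝ≥0∞} {m n : ℕ} (hmn : m ≤ n)
    (h : c ≤ stoppedProd c z m) : c ≤ stoppedProd c z n := by
  induction n, hmn using Nat.le_induction with
  | base => exact h
  | succ n _ ih => rw [stoppedProd, if_pos ih]; exact ih

lemma stoppedProd_eq_prod_or (c : ℝ≥0∞) (z : ℕ → ℝ≥0∞) (n : ℕ) :
    c ≤ stoppedProd c z n ∨ stoppedProd c z n = ∏ i ∈ Finset.range n, z i := by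
  induction n with
  | zero => right; simp [stoppedProd]
  | succ n ih =>
    by_cases h : c ≤ stoppedProd c z n
    · exact Or.inl (le_stoppedProd_of_le n.le_succ h)
    · right
      rw [stoppedProd, if_neg h, Finset.prod_range_succ, ih.resolve_left h]

lemma le_stoppedProd_of_le_prod {c : ℝ≥0∞} {z : ℕ → ℝ≥0∞} {m n : ℕ} (hmn : m ≤ n)
    (h : c ≤ ∏ i ∈ Finset.range m, z i) : c ≤ stoppedProd c z n := by
  refine le_stoppedProd_of_le hmn ?_
  rcases stoppedProd_eq_prod_or c z m with h' | h'
  · exact h'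
  · rwa [h']

variable {Ω : Type*} [MeasurableSpace Ω] {P : Measure Ω}

lemma indepFun_stoppedProd {Z : ℕ → Ω → ℝ≥0∞} (hZ : ∀ i, Measurable (Z i)) (hind : iIndepFun Z P)
    (c : ℝ≥0∞) (n : ℕ) : IndepFun (fun ω => stoppedProd c (fun i => Z i ω) n) (Z n) P := by
  have h := hind.indepFun_finset (Finset.range n) {n} (by simp) hZ
  -- Padding the first $n$ coordinates by zeros exhibits the stopped product as a measurable
  -- function of these coordinates alone.
  let ext : (Finset.range n → ℝ≥0∞) → ℕ → ℝ≥0∞ :=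
    fun y i => if hi : i ∈ Finset.range n then y ⟨i, hi⟩ else 0
  have hext : Measurable ext := by
    refine measurable_pi_lambda _ fun i => ?_
    by_cases hi : i ∈ Finset.range n
    · simpa only [ext, hi, dif_pos] using measurable_pi_apply _
    · simp only [ext, hi, dif_neg, not_false_iff]; exact measurable_const
  have h' := h.comp ((measurable_stoppedProd c n).comp hext)
    (measurable_pi_apply (⟨n, Finset.mem_singleton_self n⟩ : ({n} : Finset ℕ)))
  have hS : (fun ω => stoppedProd c (fun i => Z i ω) n) =
      ((fun z => stoppedProd c z n) ∘ ext) ∘ fun ω (i : Finset.range n) => Z i ω := by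
    funext ω
    refine stoppedProd_congr c fun i hi => ?_
    simp [ext, hi]
  rw [hS]
  exact h'

/-- The supermartingale property of the stopped product, with independence replacing conditional
expectations. Working in `ℝ≥0∞` avoids integrability, and only the factors before the horizon need
mean at most one. -/
lemma lintegral_stoppedProd_le_one [IsProbabilityMeasure P] {Z : ℕ → Ω → ℝ≥0∞}
    (hZ : ∀ i, Measurable (Z i)) (hind : iIndepFun Z P) (c : ℝ≥0∞) {n : ℕ}
    (h1 : ∀ i < n, ∫⁻ ω, Z i ω ∂P ≤ 1) :
    ∫⁻ ω, stoppedProd c (fun i => Z i ω) n ∂P ≤ 1 := by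
  induction n with
  | zero => simp [stoppedProd]
  | succ n ih =>
    refine le_trans ?_ (ih fun i hi => h1 i (hi.trans n.lt_succ_self))
    set S : Ω → ℝ≥0∞ := fun ω => stoppedProd c (fun i => Z i ω) n with hS
    have hSm : Measurable S := (measurable_stoppedProd c n).comp (measurable_pi_lambda _ hZ)
    -- Split into the frozen part, which no longer changes, and the active part, which gets
    -- multiplied by the independent factor `Z n`.
    let g₁ : ℝ≥0∞ → ℝ≥0∞ := fun s => if c ≤ s then s else 0
    let g₂ : ℝ≥0∞ → ℝ≥0∞ := fun s => if c ≤ s then 0 else s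
    have hg₁ : Measurable g₁ := Measurable.ite measurableSet_Ici measurable_id measurable_const
    have hg₂ : Measurable g₂ := Measurable.ite measurableSet_Ici measurable_const measurable_id
    have hgS : Measurable fun ω => g₁ (S ω) := hg₁.comp hSm
    have hi : IndepFun (g₂ ∘ S) (Z n) P :=
      (indepFun_stoppedProd hZ hind c n).comp hg₂ measurable_id
    calc ∫⁻ ω, stoppedProd c (fun i => Z i ω) (n + 1) ∂P
        = ∫⁻ ω, (g₁ (S ω) + ((g₂ ∘ S) * Z n) ω) ∂P := by
          refine lintegral_congr fun ω => ?_
          simp only [stoppedProd, g₁, g₂, S, Pi.mul_apply, Function.comp_apply]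
          split_ifs <;> simp
      _ = ∫⁻ ω, g₁ (S ω) ∂P + (∫⁻ ω, (g₂ ∘ S) ω ∂P) * ∫⁻ ω, Z n ω ∂P := by
          rw [lintegral_add_left hgS,
            lintegral_mul_eq_lintegral_mul_lintegral_of_indepFun (hg₂.comp hSm) (hZ n) hi]
      _ ≤ ∫⁻ ω, g₁ (S ω) ∂P + (∫⁻ ω, (g₂ ∘ S) ω ∂P) * 1 := by
          gcongr; exact h1 n n.lt_succ_self
      _ = ∫⁻ ω, S ω ∂P := by
          rw [mul_one, ← lintegral_add_left hgS]
          refine lintegral_congr fun ω => ?_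
          simp only [g₁, g₂, Function.comp_apply]
          split_ifs <;> simp

/-- Ville's inequality for the partial products of independent variables of mean at most one. -/
lemma measure_exists_le_prod_le [IsProbabilityMeasure P] {Z : ℕ → Ω → ℝ≥0∞}
    (hZ : ∀ i, Measurable (Z i)) (hind : iIndepFun Z P) {c : ℝ≥0∞} (hc0 : c ≠ 0) (hc : c ≠ ⊤)
    {N : ℕ} (h1 : ∀ i < N, ∫⁻ ω, Z i ω ∂P ≤ 1) :
    P {ω | ∃ n ≤ N, c ≤ ∏ i ∈ Finset.range n, Z i ω} ≤ c⁻¹ := by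
  have hm : Measurable fun ω => stoppedProd c (fun i => Z i ω) N :=
    (measurable_stoppedProd c N).comp (measurable_pi_lambda _ hZ)
  calc P {ω | ∃ n ≤ N, c ≤ ∏ i ∈ Finset.range n, Z i ω}
      ≤ P {ω | c ≤ stoppedProd c (fun i => Z i ω) N} :=
        measure_mono fun ω ⟨n, hn, h⟩ => le_stoppedProd_of_le_prod hn h
    _ ≤ (∫⁻ ω, stoppedProd c (fun i => Z i ω) N ∂P) / c :=
        meas_ge_le_lintegral_div hm.aemeasurable hc0 hc
    _ ≤ 1 / c := by gcongr; exact lintegral_stoppedProd_le_one hZ hind c h1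
    _ = c⁻¹ := one_div c

/-- Ville's inequality for the exponentials of sums of independent variables. -/
lemma measureReal_exists_le_sum_le [IsProbabilityMeasure P] {W : ℕ → Ω → ℝ}
    (hW : ∀ i, Measurable (W i)) (hind : iIndepFun W P) (a : ℝ) {c : ℝ} (hc : 0 < c) {N : ℕ}
    (h1 : ∀ i < N, ∫⁻ ω, ENNReal.ofReal (Real.exp (W i ω)) ∂P ≤ ENNReal.ofReal (Real.exp a)) :
    P.real {ω | ∃ n ≤ N, n * a + Real.log c ≤ ∑ i ∈ Finset.range n, W i ω} ≤ 1 / c := by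
  let g : ℝ → ℝ≥0∞ := fun w => ENNReal.ofReal (Real.exp (w - a))
  have hg : Measurable g := by fun_prop
  have hg' : ∀ w, g w = ENNReal.ofReal (Real.exp (-a)) * ENNReal.ofReal (Real.exp w) := fun w => by
    rw [← ENNReal.ofReal_mul (Real.exp_pos _).le, ← Real.exp_add, neg_add_eq_sub]
  have h := measure_exists_le_prod_le (P := P) (Z := fun i ω => g (W i ω))
    (fun i => hg.comp (hW i)) (hind.comp (fun _ => g) fun _ => hg)
    (c := ENNReal.ofReal c) (by simpa using hc) ENNReal.ofReal_ne_top (N := N) (fun i hi => by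
      simp only [hg']
      rw [lintegral_const_mul' _ _ ENNReal.ofReal_ne_top]
      calc _ ≤ ENNReal.ofReal (Real.exp (-a)) * ENNReal.ofReal (Real.exp a) := by
            gcongr; exact h1 i hi
        _ = 1 := by rw [← ENNReal.ofReal_mul (Real.exp_pos _).le, ← Real.exp_add]; simp)
  refine ENNReal.toReal_le_of_le_ofReal (by positivity) ?_
  rw [one_div, ENNReal.ofReal_inv_of_pos hc]
  refine le_trans (measure_mono ?_) h
  rintro ω ⟨n, hn, hle⟩
  refine ⟨n, hn, ?_⟩
  rw [← ENNReal.ofReal_prod_of_nonneg fun i _ => (Real.exp_pos _).le, ← Real.exp_sum]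
  refine ENNReal.ofReal_le_ofReal ?_
  rw [← Real.log_le_iff_le_exp hc, Finset.sum_sub_distrib]
  simp only [Finset.sum_const, Finset.card_range, nsmul_eq_mul]
  linarith

end Ville

/-! ### Weights, levels and radii of the exponential grid. -/

section Cells

/-- The quantity `v * cellWeight ε v γ j ^ (1 + ε)`, see `mul_cellWeight_rpow`. -/
noncomputable def cellRate (γ : ℝ) (j : ℕ) : ℝ := Real.log (2 / cellLevel γ j) * Real.exp (-(j : ℝ))

variable {ε v γ : ℝ}

lemma cellLevel_pos (hγ : 0 < γ) (j : ℕ) : 0 < cellLevel γ j := by unfold cellLevel; positivity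

lemma cellLevel_le (hγ : 0 < γ) (j : ℕ) : cellLevel γ j ≤ γ := by
  unfold cellLevel
  refine div_le_self hγ.le (one_le_pow₀ ?_)
  linarith [(Nat.cast_nonneg j : (0 : ℝ) ≤ j)]

lemma log_two_div_cellLevel_pos (hγ : 0 < γ) (hγ₁ : γ ≤ 1) (j : ℕ) :
    0 < Real.log (2 / cellLevel γ j) := by
  apply Real.log_pos
  rw [lt_div_iff₀ (cellLevel_pos hγ j)]
  linarith [cellLevel_le hγ j]

lemma cellRate_pos (hγ : 0 < γ) (hγ₁ : γ ≤ 1) (j : ℕ) : 0 < cellRate γ j :=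
  mul_pos (log_two_div_cellLevel_pos hγ hγ₁ j) (Real.exp_pos _)

/-- This balance motivates the weight: for $n$ of order $e^j$, the variance term and the log term of
the radius have the same order. -/
lemma cellRate_mul_exp (j : ℕ) : cellRate γ j * Real.exp j = Real.log (2 / cellLevel γ j) := by
  rw [cellRate, mul_assoc, ← Real.exp_add]; simp

lemma cellWeight_pos (hv : 0 < v) (hγ : 0 < γ) (hγ₁ : γ ≤ 1) (j : ℕ) :
    0 < cellWeight ε v γ j :=
  Real.rpow_pos_of_pos (div_pos (cellRate_pos hγ hγ₁ j) hv) _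

lemma cellWeight_eq (j : ℕ) : cellWeight ε v γ j = (cellRate γ j / v) ^ (1 / (1 + ε)) := rfl

lemma mul_cellWeight_rpow (hε : 0 < ε) (hv : 0 < v) (hγ : 0 < γ) (hγ₁ : γ ≤ 1) (j : ℕ) :
    v * cellWeight ε v γ j ^ (1 + ε) = cellRate γ j := by
  have := cellRate_pos hγ hγ₁ j
  rw [cellWeight_eq, ← Real.rpow_mul (by positivity), one_div_mul_cancel (by linarith),
    Real.rpow_one]
  field_simp

/-- The centred sum whose size decides membership in the stitched Catoni set. -/
noncomputable def influenceSum (ε lam : ℝ) (x : ℕ → ℝ) (n : ℕ) (m : ℝ) : ℝ :=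
  ∑ i ∈ Finset.range n, influence ε (lam * (x i - m))

/-- The half-width of the acceptance region of the stitched Catoni set, in cell `j`. -/
noncomputable def cellRadius (ε γ : ℝ) (j n : ℕ) : ℝ :=
  n * (cellRate γ j / (1 + ε)) + Real.log (2 / cellLevel γ j)

lemma mem_stitchedCI_iff (hε : 0 < ε) (hv : 0 < v) (hγ : 0 < γ) (hγ₁ : γ ≤ 1) (x : ℕ → ℝ) (n : ℕ)
    (m : ℝ) : m ∈ stitchedCI ε v γ x n ↔
      |influenceSum ε (cellWeight ε v γ (cell n)) x n m| ≤ cellRadius ε γ (cell n) n := by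
  have h : v / (1 + ε) * ∑ i ∈ Finset.range n, cellWeight ε v γ (cell n) ^ (1 + ε) =
      n * (cellRate γ (cell n) / (1 + ε)) := by
    rw [← mul_cellWeight_rpow hε hv hγ hγ₁]
    simp only [Finset.sum_const, Finset.card_range, nsmul_eq_mul]
    ring
  rw [stitchedCI, catoniCI, Set.mem_ofPred_eq, h, abs_le, influenceSum, cellRadius, neg_add,
    sub_eq_add_neg]

lemma one_le_cell (n : ℕ) : 1 ≤ cell n := le_max_left _ _

lemma cell_le {n : ℕ} (hn : 1 ≤ n) : cell n ≤ n := by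
  have hn' : (1 : ℝ) ≤ n := by exact_mod_cast hn
  refine max_le hn ((Nat.sub_le _ _).trans (Nat.ceil_le.2 ?_))
  linarith [Real.log_le_sub_one_of_pos (by linarith : (0 : ℝ) < n)]

lemma sum_cellLevel_le (hγ : 0 < γ) (N : ℕ) :
    ∑ j ∈ Finset.Icc 1 N, cellLevel γ j ≤ γ := by
  have h : ∀ N : ℕ, ∑ j ∈ Finset.Icc 1 N, cellLevel γ j ≤ γ * (1 - 1 / ((N : ℝ) + 1)) := by
    intro N
    induction N with
    | zero => simp
    | succ N ih =>
      rw [Finset.sum_Icc_succ_top (by omega)]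
      -- Telescoping; since cells start at $j=1$, the total stays below $\gamma$ itself.
      have : cellLevel γ (N + 1) ≤ γ * (1 / ((N : ℝ) + 1) - 1 / ((N : ℝ) + 2)) := by
        unfold cellLevel
        rw [div_eq_mul_one_div]
        gcongr
        rw [div_sub_div _ _ (by positivity) (by positivity), div_le_div_iff₀ (by positivity)
          (by positivity)]
        push_cast
        nlinarith [(Nat.cast_nonneg N : (0 : ℝ) ≤ N)]
      push_cast
      have h2 : ((N : ℝ) + 1 + 1) = N + 2 := by ring
      rw [h2]
      linarith
  refine (h N).trans ?_
  have : 0 ≤ 1 / ((N : ℝ) + 1) := by positivity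
  nlinarith

end Cells

/-! ### Time-uniform coverage of the mean. -/

section ConfidenceSequence

variable {ε v γ : ℝ} {Ω : Type*} [MeasurableSpace Ω] {P : Measure Ω} {ν : Measure ℝ}

lemma lintegral_rpow_of_heavyTailed (hν : HeavyTailed ε v ν) {Y : Ω → ℝ}
    (hY : Measurable Y) (hlaw : P.map Y = ν) (s : ℝ) :
    ∫⁻ ω, ENNReal.ofReal (|s * (Y ω - ∫ x, x ∂ν)| ^ (1 + ε)) ∂P
      ≤ ENNReal.ofReal (v * |s| ^ (1 + ε)) := by
  have h := hν.2
  rw [← hlaw, lintegral_map (by fun_prop) hY, hlaw] at h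
  calc ∫⁻ ω, ENNReal.ofReal (|s * (Y ω - ∫ x, x ∂ν)| ^ (1 + ε)) ∂P
      = ∫⁻ ω, ENNReal.ofReal (|s| ^ (1 + ε)) * ENNReal.ofReal (|Y ω - ∫ x, x ∂ν| ^ (1 + ε)) ∂P := by
        refine lintegral_congr fun ω => ?_
        rw [abs_mul, Real.mul_rpow (abs_nonneg _) (abs_nonneg _),
          ENNReal.ofReal_mul (by positivity)]
    _ ≤ ENNReal.ofReal (|s| ^ (1 + ε)) * ENNReal.ofReal v := by
        rw [lintegral_const_mul' _ _ ENNReal.ofReal_ne_top]; gcongr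
    _ = _ := by rw [← ENNReal.ofReal_mul (by positivity), mul_comm]

lemma measurable_influence (hε : 0 < ε) : Measurable (influence ε) := (influence_mono hε).measurable

lemma iIndepFun_influence (hε : 0 < ε) {Y : ℕ → Ω → ℝ} (hind : iIndepFun Y P) (s μ z : ℝ) :
    iIndepFun (fun i ω => influence ε (s * (Y i ω - μ) - z)) P :=
  hind.comp (fun _ y => influence ε (s * (y - μ) - z))
    fun _ => (measurable_influence hε).comp (by fun_prop)

variable [IsProbabilityMeasure P]

lemma integrable_of_heavyTailed (hν : HeavyTailed ε v ν) {Y : Ω → ℝ} (hY : Measurable Y)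
    (hlaw : P.map Y = ν) (s : ℝ) : Integrable (fun ω => s * (Y ω - ∫ x, x ∂ν)) P := by
  have : Integrable Y P := by
    have h := hν.1
    rw [← hlaw] at h
    exact h.comp_measurable hY
  exact (this.sub (integrable_const _)).const_mul s

lemma integral_of_heavyTailed (hν : HeavyTailed ε v ν) {Y : Ω → ℝ} (hY : Measurable Y)
    (hlaw : P.map Y = ν) (s : ℝ) : ∫ ω, s * (Y ω - ∫ x, x ∂ν) ∂P = 0 := by
  have hi : Integrable Y P := by
    have h := hν.1
    rw [← hlaw] at h
    exact h.comp_measurable hY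
  have h : ∫ x, x ∂ν = ∫ ω, Y ω ∂P := by
    rw [← hlaw, integral_map hY.aemeasurable (f := fun x => x) aestronglyMeasurable_id]
  rw [integral_const_mul, integral_sub hi (integrable_const _), h]
  simp

/-- One-sided time-uniform deviation bound at the mean. -/
lemma measureReal_exists_influenceSum_ge_le (hε : 0 < ε) (hε₁ : ε ≤ 1) (hv : 0 < v)
    (hν : HeavyTailed ε v ν) {Y : ℕ → Ω → ℝ} (hY : ∀ i, Measurable (Y i)) (hind : iIndepFun Y P)
    {N : ℕ} (hlaw : ∀ i < N, P.map (Y i) = ν) (s : ℝ) {c : ℝ} (hc : 0 < c) :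
    P.real {ω | ∃ n ≤ N, n * (v * |s| ^ (1 + ε) / (1 + ε)) + Real.log c ≤
      influenceSum ε s (fun i => Y i ω) n (∫ x, x ∂ν)} ≤ 1 / c := by
  have h := measureReal_exists_le_sum_le (P := P)
    (W := fun i ω => influence ε (s * (Y i ω - ∫ x, x ∂ν) - 0))
    (fun i => (measurable_influence hε).comp (by have := hY i; fun_prop))
    (iIndepFun_influence hε hind s _ 0) (v * |s| ^ (1 + ε) / (1 + ε)) hc (N := N) fun i hi => by
      simp only [sub_zero]
      exact lintegral_exp_influence_le hε hε₁ (by have := hY i; fun_prop)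
        (integrable_of_heavyTailed hν (hY i) (hlaw i hi) s)
        (integral_of_heavyTailed hν (hY i) (hlaw i hi) s)
        (lintegral_rpow_of_heavyTailed hν (hY i) (hlaw i hi) s) (by positivity)
  simpa only [sub_zero, influenceSum] using h

lemma influenceSum_neg (lam : ℝ) (x : ℕ → ℝ) (n : ℕ) (m : ℝ) :
    influenceSum ε (-lam) x n m = -influenceSum ε lam x n m := by
  simp only [influenceSum, neg_mul, influence_neg, Finset.sum_neg_distrib]

/-- The weight and level of cell $j$ are kept for every $n\le N$, inside the cell or not, so that
one application of Ville per side suffices. Each side costs $\gamma_j/2$; the lower one follows from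
oddness with weight $-\lambda$. -/
lemma measureReal_exists_notMem_cell_le (hε : 0 < ε) (hε₁ : ε ≤ 1) (hv : 0 < v)
    (hγ : 0 < γ) (hγ₁ : γ ≤ 1)
    (hν : HeavyTailed ε v ν) {Y : ℕ → Ω → ℝ} (hY : ∀ i, Measurable (Y i)) (hind : iIndepFun Y P)
    {N : ℕ} (hlaw : ∀ i < N, P.map (Y i) = ν) (j : ℕ) :
    P.real {ω | ∃ n ≤ N, cellRadius ε γ j n <
      |influenceSum ε (cellWeight ε v γ j) (fun i => Y i ω) n (∫ x, x ∂ν)|} ≤ cellLevel γ j := by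
  have hlam := cellWeight_pos (ε := ε) hv hγ hγ₁ j
  have hc : 0 < 2 / cellLevel γ j := div_pos two_pos (cellLevel_pos hγ j)
  have h1 := measureReal_exists_influenceSum_ge_le hε hε₁ hv hν hY hind hlaw
    (cellWeight ε v γ j) hc
  have h2 := measureReal_exists_influenceSum_ge_le hε hε₁ hv hν hY hind hlaw
    (-cellWeight ε v γ j) hc
  rw [abs_neg] at h2
  rw [abs_of_pos hlam, mul_cellWeight_rpow hε hv hγ hγ₁] at h1 h2
  refine (measureReal_mono ?_).trans ((measureReal_union_le _ _).trans ((add_le_add h1 h2).trans ?_))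
  · rintro ω ⟨n, hn, hlt⟩
    rcases lt_abs.1 hlt with h | h
    · exact Or.inl ⟨n, hn, h.le⟩
    · refine Or.inr ⟨n, hn, ?_⟩
      rw [influenceSum_neg]
      exact h.le
  · rw [one_div_div]; linarith

/-- The stitched Catoni sets contain the mean, uniformly up to a finite horizon. -/
lemma measureReal_exists_notMem_stitchedCI_le (hε : 0 < ε) (hε₁ : ε ≤ 1) (hv : 0 < v)
    (hγ : 0 < γ) (hγ₁ : γ ≤ 1)
    (hν : HeavyTailed ε v ν) {Y : ℕ → Ω → ℝ} (hY : ∀ i, Measurable (Y i)) (hind : iIndepFun Y P)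
    {N : ℕ} (hlaw : ∀ i < N, P.map (Y i) = ν) :
    P.real {ω | ∃ n, 1 ≤ n ∧ n ≤ N ∧ (∫ x, x ∂ν) ∉ stitchedCI ε v γ (fun i => Y i ω) n} ≤ γ := by
  refine le_trans (measureReal_mono (s₂ := ⋃ j ∈ Finset.Icc 1 N, {ω | ∃ n ≤ N, cellRadius ε γ j n <
      |influenceSum ε (cellWeight ε v γ j) (fun i => Y i ω) n (∫ x, x ∂ν)|}) ?_ (measure_ne_top _ _))
    ((measureReal_biUnion_finset_le _ _).trans ((Finset.sum_le_sum fun j _ =>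
      measureReal_exists_notMem_cell_le hε hε₁ hv hγ hγ₁ hν hY hind hlaw j).trans
        (sum_cellLevel_le hγ N)))
  rintro ω ⟨n, h1n, hnN, hmem⟩
  rw [mem_stitchedCI_iff hε hv hγ hγ₁, not_le] at hmem
  simp only [Set.mem_iUnion]
  -- A finite union of cells is enough, since sizes up to $N$ only meet cells $1,\dots,N$.
  exact ⟨cell n, Finset.mem_Icc.2 ⟨one_le_cell n, (cell_le h1n).trans hnN⟩, n, hnN, hmem⟩

/-- Subadditivity alone gives this direction, so the events need no measurability. -/
lemma one_sub_le_measureReal_of_compl {S : Set Ω} {a : ℝ} (h : P.real Sᶜ ≤ a) :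
    1 - a ≤ P.real S := by
  have h1 := measureReal_union_le (μ := P) S Sᶜ
  rw [Set.union_compl_self, probReal_univ] at h1
  linarith

/-- The stitched Catoni sets form a confidence sequence. -/
lemma one_sub_le_measureReal_forall_mem_stitchedCI (hε : 0 < ε) (hε₁ : ε ≤ 1) (hv : 0 < v)
    (hγ : 0 < γ) (hγ₁ : γ ≤ 1) (hν : HeavyTailed ε v ν) {Y : ℕ → Ω → ℝ}
    (hY : IsIIDStream P Y ν) :
    1 - γ ≤ P.real {ω | ∀ n : ℕ, 1 ≤ n →
      (∫ x, x ∂ν) ∈ stitchedCI ε v γ (fun i => Y i ω) n} := by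
  apply one_sub_le_measureReal_of_compl
  refine ENNReal.toReal_le_of_le_ofReal hγ.le ?_
  -- The failures up to horizon $N$ increase to the full failure event, and continuity from below
  -- carries over the uniform bound.
  have hU : {ω | ∀ n : ℕ, 1 ≤ n → (∫ x, x ∂ν) ∈ stitchedCI ε v γ (fun i => Y i ω) n}ᶜ =
      ⋃ N : ℕ, {ω | ∃ n, 1 ≤ n ∧ n ≤ N ∧ (∫ x, x ∂ν) ∉ stitchedCI ε v γ (fun i => Y i ω) n} := by
    ext ω
    simp only [Set.mem_compl_iff, Set.mem_ofPred_eq, not_forall, Set.mem_iUnion]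
    constructor
    · rintro ⟨n, h1, h2⟩
      exact ⟨n, n, h1, le_rfl, h2⟩
    · rintro ⟨_, n, h1, _, h2⟩
      exact ⟨n, h1, h2⟩
  rw [hU, Monotone.measure_iUnion]
  · refine iSup_le fun N => ?_
    rw [ENNReal.le_ofReal_iff_toReal_le (measure_ne_top _ _) hγ.le]
    exact measureReal_exists_notMem_stitchedCI_le hε hε₁ hv hγ hγ₁ hν hY.measurable hY.indep
      fun i _ => hY.law i
  · rintro N M hNM ω ⟨n, h1, h2, h3⟩
    exact ⟨n, h1, h2.trans hNM, h3⟩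

end ConfidenceSequence

/-! ### Size of the cell parameters in terms of the sample size. -/

section CellBounds

variable {ε v γ : ℝ}

lemma natCast_le_exp_cell {n : ℕ} (hn : 1 ≤ n) : (n : ℝ) ≤ Real.exp (cell n + 1) := by
  have hn' : (0 : ℝ) < n := by exact_mod_cast hn
  rw [← Real.log_le_iff_le_exp hn']
  refine (Nat.le_ceil _).trans ?_
  have : ⌈Real.log n⌉₊ ≤ cell n + 1 := by unfold cell; omega
  exact_mod_cast this

lemma cell_lt_log {n : ℕ} (hn : 1 < Real.log n) : (cell n : ℝ) < Real.log n := by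
  have h := Nat.ceil_lt_add_one (by linarith : 0 ≤ Real.log n)
  have h1 : 1 ≤ ⌈Real.log n⌉₊ := Nat.one_le_ceil_iff.2 (by linarith)
  rcases max_choice 1 (⌈Real.log n⌉₊ - 1) with h' | h'
  · rw [cell, h']; simpa using hn
  · rw [cell, h', Nat.cast_sub h1]; push_cast; linarith

lemma cell_le_log_add_one (n : ℕ) : (cell n : ℝ) ≤ Real.log n + 1 := by
  have h0 : 0 ≤ Real.log n := Real.log_natCast_nonneg n
  by_cases h : 1 < Real.log n
  · linarith [cell_lt_log h]
  · have : ⌈Real.log n⌉₊ ≤ 1 := Nat.ceil_le.2 (by push_cast; linarith)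
    have : cell n = 1 := by unfold cell; omega
    rw [this]; push_cast; linarith

lemma exp_cell_le {n : ℕ} (hn : 1 < Real.log n) : Real.exp (cell n) ≤ n := by
  have hn' : (0 : ℝ) < n := by
    rcases Nat.eq_zero_or_pos n with rfl | h
    · simp at hn; linarith
    · exact_mod_cast h
  rw [← Real.le_log_iff_exp_le hn']
  exact (cell_lt_log hn).le

lemma log_two_div_cellLevel (hγ : 0 < γ) (j : ℕ) :
    Real.log (2 / cellLevel γ j) = Real.log (2 / γ) + 2 * Real.log (j + 1) := by
  have hj : (0 : ℝ) < j + 1 := by positivity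
  rw [cellLevel, div_div_eq_mul_div, mul_div_right_comm, Real.log_mul (by positivity)
    (by positivity), Real.log_pow]
  push_cast; ring

lemma exp_one_le_three : Real.exp 1 ≤ 3 := by linarith [Real.exp_one_lt_d9]

/-- The shape of the width bound. -/
noncomputable def widthRate (γ : ℝ) (n : ℕ) : ℝ :=
  (Real.log (2 / γ) + 2 * Real.log (Real.log (Real.exp 2 * n))) / n

lemma log_exp_two_mul {n : ℕ} (hn : 1 ≤ n) : Real.log (Real.exp 2 * n) = 2 + Real.log n := by
  have : (n : ℝ) ≠ 0 := by positivity
  rw [Real.log_mul (Real.exp_pos _).ne' this, Real.log_exp]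

lemma cellRate_le_widthRate (hγ : 0 < γ) (hγ₁ : γ ≤ 1) {n : ℕ} (hn : 1 ≤ n) :
    cellRate γ (cell n) ≤ 3 * widthRate γ n := by
  have hn' : (0 : ℝ) < n := by exact_mod_cast hn
  have h1 : Real.log (2 / cellLevel γ (cell n)) ≤
      Real.log (2 / γ) + 2 * Real.log (Real.log (Real.exp 2 * n)) := by
    rw [log_two_div_cellLevel hγ, log_exp_two_mul hn]
    have := Real.log_le_log (by positivity : (0 : ℝ) < cell n + 1)
      (by linarith [cell_le_log_add_one n] : (cell n : ℝ) + 1 ≤ 2 + Real.log n)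
    linarith
  have h2 : Real.exp (-(cell n : ℝ)) ≤ 3 / n := by
    rw [Real.exp_neg, inv_eq_one_div, div_le_div_iff₀ (Real.exp_pos _) hn', one_mul]
    calc (n : ℝ) ≤ Real.exp (cell n + 1) := natCast_le_exp_cell hn
      _ = Real.exp 1 * Real.exp (cell n) := by rw [add_comm, Real.exp_add]
      _ ≤ 3 * Real.exp (cell n) := by gcongr; exact exp_one_le_three
  calc cellRate γ (cell n) ≤ Real.log (2 / cellLevel γ (cell n)) * (3 / n) := by
        unfold cellRate
        gcongr
        exact (log_two_div_cellLevel_pos hγ hγ₁ _).le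
    _ ≤ (Real.log (2 / γ) + 2 * Real.log (Real.log (Real.exp 2 * n))) * (3 / n) := by gcongr
    _ = 3 * widthRate γ n := by unfold widthRate; ring

lemma log_le_of_nMin_le (hε : 0 < ε) (hε₁ : ε ≤ 1) {T n : ℕ} (hT : 2 ≤ T) (hn : nMin ε T ≤ n) :
    136 * Real.log T ≤ n := by
  have hT' : (2 : ℝ) ≤ T := by exact_mod_cast hT
  have hlog : 0 ≤ Real.log T := Real.log_nonneg (by linarith)
  rw [nMin, Real.log_rpow (by linarith)] at hn
  have : 2 ≤ (1 + ε) / ε := by rw [le_div_iff₀ hε]; linarith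
  nlinarith

lemma half_lt_log {T : ℕ} (hT : 2 ≤ T) : 69 / 100 < Real.log T := by
  have hT' : (2 : ℝ) ≤ T := by exact_mod_cast hT
  linarith [Real.log_two_gt_d9, Real.log_le_log two_pos hT']

lemma four_lt_log_of_nMin_le (hε : 0 < ε) (hε₁ : ε ≤ 1) {T n : ℕ} (hT : 2 ≤ T)
    (hn : nMin ε T ≤ n) : 4 < Real.log n := by
  have h1 := log_le_of_nMin_le hε hε₁ hT hn
  have h2 := half_lt_log hT
  rw [Real.lt_log_iff_exp_lt (by linarith)]
  have h3 : Real.exp 4 = Real.exp 1 ^ 4 := by rw [← Real.exp_nat_mul]; norm_num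
  have h4 : Real.exp 1 ^ 4 ≤ 3 ^ 4 := by gcongr; exact exp_one_le_three
  rw [h3]; linarith

lemma four_le_cell {n : ℕ} (hn : 4 < Real.log n) : 4 ≤ cell n := by
  have : 4 < ⌈Real.log n⌉₊ := Nat.lt_ceil.2 (by exact_mod_cast hn)
  unfold cell; omega

lemma level_pos {T : ℕ} (hT : 2 ≤ T) : 0 < 2 / (T : ℝ) ^ 3 := by
  have hT' : (0 : ℝ) < T := Nat.cast_pos.2 (two_pos.trans_le hT)
  positivity

lemma level_le {T : ℕ} (hT : 2 ≤ T) : 2 / (T : ℝ) ^ 3 ≤ 1 / 4 := by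
  have hT' : (2 : ℝ) ≤ T := by exact_mod_cast hT
  have : (2 : ℝ) ^ 3 ≤ (T : ℝ) ^ 3 := by gcongr
  rw [div_le_iff₀ (by positivity)]; linarith

lemma log_two_div_level (T : ℕ) :
    Real.log (2 / (2 / (T : ℝ) ^ 3)) = 3 * Real.log T := by
  rw [div_div_cancel₀ two_ne_zero, Real.log_pow]; norm_num

/-- This is what the minimal sample size is for. It gives $3\log T\le 3n/136\le 9e^j/136$, and it
forces $j\ge 4$, where $e^j\ge 50(j-3)$ dominates the remaining $2\log(j+1)$. -/
lemma cellRate_le_quarter (hε : 0 < ε) (hε₁ : ε ≤ 1) {T n : ℕ} (hT : 2 ≤ T)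
    (hn : nMin ε T ≤ n) : cellRate (2 / (T : ℝ) ^ 3) (cell n) ≤ 1 / 4 := by
  have h4 := four_lt_log_of_nMin_le hε hε₁ hT hn
  have h1n : 1 ≤ n := by
    rcases Nat.eq_zero_or_pos n with rfl | h
    · simp at h4; linarith
    · exact h
  have hj : (4 : ℝ) ≤ cell n := by exact_mod_cast four_le_cell h4
  have h136 := log_le_of_nMin_le hε hε₁ hT hn
  set j : ℝ := (cell n : ℝ)
  have hnj : (n : ℝ) ≤ Real.exp j * Real.exp 1 := by
    rw [← Real.exp_add]; exact natCast_le_exp_cell h1n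
  have hej : 50 * (j - 3) ≤ Real.exp j := by
    have h1 : Real.exp j = Real.exp 1 ^ 4 * Real.exp (j - 4) := by
      rw [← Real.exp_nat_mul, ← Real.exp_add]; congr 1; push_cast; ring
    have h2 : (27 / 10 : ℝ) ^ 4 ≤ Real.exp 1 ^ 4 := by
      gcongr; linarith [Real.exp_one_gt_d9]
    have h3 := Real.add_one_le_exp (j - 4)
    rw [h1]
    nlinarith
  have hlog : Real.log (j + 1) ≤ (j + 1) / 5 + 1 := by
    have h1 := Real.log_le_sub_one_of_pos (by linarith : 0 < (j + 1) / 5)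
    have h2 : Real.log (j + 1) = Real.log ((j + 1) / 5) + Real.log 5 := by
      rw [← Real.log_mul (by linarith) (by norm_num)]; congr 1; ring
    have h3 : Real.log 5 ≤ 2 := by
      rw [Real.log_le_iff_le_exp (by norm_num)]
      have h5 : Real.exp 2 = Real.exp 1 ^ 2 := by rw [← Real.exp_nat_mul]; norm_num
      rw [h5]
      nlinarith [Real.exp_one_gt_d9]
    linarith
  rw [cellRate, log_two_div_cellLevel (level_pos hT), log_two_div_level T, Real.exp_neg,
    ← div_eq_mul_inv, div_le_iff₀ (Real.exp_pos _)]
  nlinarith [exp_one_le_three, Real.exp_pos j]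

end CellBounds

/-! ### Lower and upper bounds on the width, and its measurability. -/

section Width

variable {ε v γ : ℝ}

lemma influenceSum_anti (hε : 0 < ε) {lam : ℝ} (hlam : 0 < lam) (x : ℕ → ℝ) (n : ℕ) :
    Antitone (influenceSum ε lam x n) := by
  intro m m' h
  refine Finset.sum_le_sum fun i _ => influence_mono hε ?_
  gcongr

lemma continuous_influenceSum (hε : 0 < ε) (hε₁ : ε ≤ 1) (lam : ℝ) (x : ℕ → ℝ) (n : ℕ) :
    Continuous (influenceSum ε lam x n) :=
  continuous_finsetSum _ fun i _ => (continuous_influence hε hε₁).comp (by fun_prop)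

lemma influenceSum_sub_le (hε : 0 < ε) (hε₁ : ε ≤ 1) {lam : ℝ} (hlam : 0 < lam) (x : ℕ → ℝ) (n : ℕ)
    (m : ℝ) {h : ℝ} (hh : 0 ≤ h) :
    influenceSum ε lam x n m - influenceSum ε lam x n (m + h) ≤ 2 * n * lam * h := by
  rw [influenceSum, influenceSum, ← Finset.sum_sub_distrib]
  calc _ ≤ ∑ i ∈ Finset.range n, 2 * (lam * h) := by
        refine Finset.sum_le_sum fun i _ => ?_
        have h0 : lam * (x i - (m + h)) ≤ lam * (x i - m) := by gcongr; linarith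
        refine (influence_sub_le hε hε₁ h0).trans_eq ?_
        ring
    _ = _ := by simp only [Finset.sum_const, Finset.card_range, nsmul_eq_mul]; ring

lemma exists_influenceSum_eq_zero (hε : 0 < ε) (hε₁ : ε ≤ 1) {lam : ℝ} (hlam : 0 < lam)
    (x : ℕ → ℝ) (n : ℕ) : ∃ m, influenceSum ε lam x n m = 0 := by
  set M := ∑ i ∈ Finset.range n, |x i|
  have hM : ∀ i ∈ Finset.range n, |x i| ≤ M := fun i hi =>
    Finset.single_le_sum (f := fun i => |x i|) (fun i _ => abs_nonneg _) hi
  have hM0 : 0 ≤ M := Finset.sum_nonneg fun i _ => abs_nonneg _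
  have h1 : 0 ≤ influenceSum ε lam x n (-M) := by
    refine Finset.sum_nonneg fun i hi => influence_nonneg hε (mul_nonneg hlam.le ?_)
    linarith [(abs_le.1 (hM i hi)).1]
  have h2 : influenceSum ε lam x n M ≤ 0 := by
    refine Finset.sum_nonpos fun i hi => influence_nonpos hε
      (mul_nonpos_of_nonneg_of_nonpos hlam.le ?_)
    linarith [(abs_le.1 (hM i hi)).2]
  obtain ⟨m, -, hm⟩ := intermediate_value_Icc' (by linarith : -M ≤ M)
    (continuous_influenceSum hε hε₁ lam x n).continuousOn ⟨h2, h1⟩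
  exact ⟨m, hm⟩

lemma cellRadius_nonneg (hε : 0 < ε) (hγ : 0 < γ) (hγ₁ : γ ≤ 1) (j n : ℕ) :
    0 ≤ cellRadius ε γ j n := by
  have := cellRate_pos hγ hγ₁ j
  have := log_two_div_cellLevel_pos hγ hγ₁ j
  unfold cellRadius; positivity

lemma div_cellWeight_eq (hε : 0 < ε) (hv : 0 < v) (hγ : 0 < γ) (hγ₁ : γ ≤ 1) (j : ℕ) :
    cellRate γ j / cellWeight ε v γ j = v ^ (1 / (1 + ε)) * cellRate γ j ^ (ε / (1 + ε)) := by
  have hA := cellRate_pos hγ hγ₁ j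
  rw [cellWeight_eq, Real.div_rpow hA.le hv.le, div_div_eq_mul_div, mul_comm, mul_div_assoc]
  congr 1
  rw [← Real.rpow_one_sub' hA.le]
  · congr 1; field_simp; ring
  · have : 1 - 1 / (1 + ε) = ε / (1 + ε) := by field_simp; ring
    rw [this]; positivity

/-- The width of the stitched Catoni set is never smaller than its typical order. -/
lemma le_of_widthLE (hε : 0 < ε) (hε₁ : ε ≤ 1) (hv : 0 < v) (hγ : 0 < γ) (hγ₁ : γ ≤ 1)
    (x : ℕ → ℝ) {n : ℕ} (hn : 1 ≤ n) {w : ℝ} (h : WidthLE (stitchedCI ε v γ x n) w) :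
    v ^ (1 / (1 + ε)) * cellRate γ (cell n) ^ (ε / (1 + ε)) / 6 ≤ w := by
  have hlam := cellWeight_pos (ε := ε) hv hγ hγ₁ (cell n)
  have hA := cellRate_pos hγ hγ₁ (cell n)
  rw [← div_cellWeight_eq hε hv hγ hγ₁]
  set j := cell n with hj
  set lam := cellWeight ε v γ j
  -- With slope at most $2n\lambda$, moving $d$ away from a zero of the sum changes it by at most
  -- $nA/3$. This is at most $\log(2/\gamma_j)$, since $n\le e\cdot e^j$ and $e\le 3$, so both
  -- points are accepted.
  set d := cellRate γ j / lam / 6 with hd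
  have hd0 : 0 < d := by positivity
  obtain ⟨m, hm⟩ := exists_influenceSum_eq_zero hε hε₁ hlam x n
  have hR : 2 * n * lam * d ≤ cellRadius ε γ j n := by
    have h1 : 2 * n * lam * d = n * cellRate γ j / 3 := by rw [hd]; field_simp; norm_num
    have h2 : n * cellRate γ j ≤ 3 * Real.log (2 / cellLevel γ j) := by
      rw [← cellRate_mul_exp]
      calc n * cellRate γ j ≤ Real.exp (j + 1) * cellRate γ j := by
            gcongr; exact natCast_le_exp_cell hn
        _ = Real.exp 1 * (cellRate γ j * Real.exp j) := by rw [Real.exp_add]; ring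
        _ ≤ _ := by gcongr; exact exp_one_le_three
    have h3 : 0 ≤ n * (cellRate γ j / (1 + ε)) := by positivity
    unfold cellRadius; linarith
  have hm1 : m ∈ stitchedCI ε v γ x n := by
    rw [mem_stitchedCI_iff hε hv hγ hγ₁, hm, abs_zero]
    exact cellRadius_nonneg hε hγ hγ₁ _ _
  have hm2 : m + d ∈ stitchedCI ε v γ x n := by
    rw [mem_stitchedCI_iff hε hv hγ hγ₁]
    have h1 := influenceSum_sub_le hε hε₁ hlam x n m hd0.le
    have h2 := influenceSum_anti hε hlam x n (by linarith : m ≤ m + d)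
    rw [hm] at h1 h2
    rw [abs_of_nonpos h2]
    linarith
  have := h m hm1 (m + d) hm2
  rwa [abs_sub_comm, add_sub_cancel_left, abs_of_pos hd0] at this

lemma widthLE_of_influenceSum (hε : 0 < ε) (hv : 0 < v) (hγ : 0 < γ) (hγ₁ : γ ≤ 1)
    {x : ℕ → ℝ} {n : ℕ} {μ d : ℝ}
    (h1 : influenceSum ε (cellWeight ε v γ (cell n)) x n (μ + d) < -cellRadius ε γ (cell n) n)
    (h2 : cellRadius ε γ (cell n) n < influenceSum ε (cellWeight ε v γ (cell n)) x n (μ - d)) :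
    WidthLE (stitchedCI ε v γ x n) (2 * d) := by
  have hanti := influenceSum_anti hε (cellWeight_pos (ε := ε) hv hγ hγ₁ (cell n)) x n
  have key : ∀ m ∈ stitchedCI ε v γ x n, μ - d < m ∧ m < μ + d := by
    intro m hm
    rw [mem_stitchedCI_iff hε hv hγ hγ₁, abs_le] at hm
    constructor
    · by_contra! hle
      linarith [hanti hle]
    · by_contra! hle
      linarith [hanti hle]
  intro m hm m' hm'
  have := key m hm
  have := key m' hm'
  rw [abs_le]; constructor <;> linarith

lemma ordConnected_stitchedCI (hε : 0 < ε) (hv : 0 < v) (hγ : 0 < γ) (hγ₁ : γ ≤ 1)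
    (x : ℕ → ℝ) (n : ℕ) : (stitchedCI ε v γ x n).OrdConnected := by
  have hanti := influenceSum_anti hε (cellWeight_pos (ε := ε) hv hγ hγ₁ (cell n)) x n
  refine ⟨fun m hm m' hm' y hy => ?_⟩
  rw [mem_stitchedCI_iff hε hv hγ hγ₁, abs_le] at *
  exact ⟨hm'.1.trans (hanti hy.2), (hanti hy.1).trans hm.2⟩

/-- In an interval, points that are too far apart can be moved inwards to rational ones; the width
event thereby becomes a countable intersection. -/
lemma widthLE_iff_rat {S : Set ℝ} (hS : S.OrdConnected) {w : ℝ} (hw : 0 ≤ w) :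
    WidthLE S w ↔ ∀ q q' : ℚ, (q : ℝ) ∈ S → (q' : ℝ) ∈ S → (q' : ℝ) - q ≤ w := by
  constructor
  · intro h q q' hq hq'
    exact (le_abs_self _).trans (h _ hq' _ hq)
  · intro h
    have key : ∀ m ∈ S, ∀ m' ∈ S, m' - m ≤ w := by
      intro m hm m' hm'
      by_contra! hlt
      obtain ⟨q, hq1, hq2⟩ := exists_rat_btwn (by linarith : m < m' - w)
      obtain ⟨q', hq1', hq2'⟩ := exists_rat_btwn (by linarith : q + w < m')
      have h1 := h q q' (hS.out hm hm' ⟨hq1.le, by linarith⟩)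
        (hS.out hm hm' ⟨by linarith, hq2'.le⟩)
      linarith
    intro m hm m' hm'
    rw [abs_le]
    exact ⟨by linarith [key m hm m' hm'], key m' hm' m hm⟩

variable {Ω : Type*} [MeasurableSpace Ω] {P : Measure Ω}

lemma measurableSet_mem_stitchedCI (hε : 0 < ε) (hv : 0 < v) (hγ : 0 < γ) (hγ₁ : γ ≤ 1)
    {Y : ℕ → Ω → ℝ} (hY : ∀ i, Measurable (Y i)) (n : ℕ) (m : ℝ) :
    MeasurableSet {ω | m ∈ stitchedCI ε v γ (fun i => Y i ω) n} := by
  simp only [mem_stitchedCI_iff hε hv hγ hγ₁, influenceSum]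
  refine measurableSet_le (Measurable.abs (Finset.measurable_fun_sum _ fun i _ => ?_))
    measurable_const
  exact (measurable_influence hε).comp (by have := hY i; fun_prop)

lemma measurableSet_widthLE (hε : 0 < ε) (hv : 0 < v) (hγ : 0 < γ) (hγ₁ : γ ≤ 1)
    {Y : ℕ → Ω → ℝ} (hY : ∀ i, Measurable (Y i)) (n : ℕ) {w : ℝ} (hw : 0 ≤ w) :
    MeasurableSet {ω | WidthLE (stitchedCI ε v γ (fun i => Y i ω) n) w} := by
  simp only [widthLE_iff_rat (ordConnected_stitchedCI hε hv hγ hγ₁ _ n) hw]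
  have hm := measurableSet_mem_stitchedCI hε hv hγ hγ₁ hY n
  have : ∀ q q' : ℚ, MeasurableSet {ω | (q : ℝ) ∈ stitchedCI ε v γ (fun i => Y i ω) n →
      (q' : ℝ) ∈ stitchedCI ε v γ (fun i => Y i ω) n → (q' : ℝ) - q ≤ w} := fun q q' =>
    (hm q).imp ((hm q').imp (MeasurableSet.const _))
  have h := MeasurableSet.iInter fun q => MeasurableSet.iInter fun q' => this q q'
  convert h using 1
  ext ω
  simp

variable [IsProbabilityMeasure P] {ν : Measure ℝ}

/-- One-sided deviation bound at a point away from the mean. -/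
lemma measureReal_influenceSum_shift_ge_le (hε : 0 < ε) (hε₁ : ε ≤ 1)
    (hν : HeavyTailed ε v ν) {Y : ℕ → Ω → ℝ} (hY : ∀ i, Measurable (Y i)) (hind : iIndepFun Y P)
    {n : ℕ} (hlaw : ∀ i < n, P.map (Y i) = ν) {s A : ℝ} (hs : s ≠ 0) (hA : v * |s| ^ (1 + ε) = A)
    (hA0 : 0 < A) (hA4 : A ≤ 1 / 4) {c : ℝ} (hc : 0 < c) :
    P.real {ω | n * (-(3 * A)) + Real.log c ≤
      influenceSum ε s (fun i => Y i ω) n (∫ x, x ∂ν + shift ε A / s)} ≤ 1 / c := by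
  have h := measureReal_exists_le_sum_le (P := P)
    (W := fun i ω => influence ε (s * (Y i ω - ∫ x, x ∂ν) - shift ε A))
    (fun i => (measurable_influence hε).comp (by have := hY i; fun_prop))
    (iIndepFun_influence hε hind s _ _) (-(3 * A)) hc (N := n) fun i hi =>
      lintegral_exp_influence_sub_shift_le hε hε₁ (by have := hY i; fun_prop)
        (integrable_of_heavyTailed hν (hY i) (hlaw i hi) s)
        (integral_of_heavyTailed hν (hY i) (hlaw i hi) s)
        (hA ▸ lintegral_rpow_of_heavyTailed hν (hY i) (hlaw i hi) s) hA0 hA4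
  refine (measureReal_mono ?_).trans h
  intro ω hω
  refine ⟨n, le_rfl, hω.trans_eq (Finset.sum_congr rfl fun i _ => ?_)⟩
  congr 1
  field_simp
  ring

/-- With high probability, the stitched Catoni set lies within one shift of the mean. -/
lemma measureReal_compl_widthLE_shift_le (hε : 0 < ε) (hε₁ : ε ≤ 1) (hv : 0 < v)
    (hγ : 0 < γ) (hγ₁ : γ ≤ 1)
    (hν : HeavyTailed ε v ν) {Y : ℕ → Ω → ℝ} (hY : ∀ i, Measurable (Y i)) (hind : iIndepFun Y P)
    {n : ℕ} (hlaw : ∀ i < n, P.map (Y i) = ν) (hn : 1 < Real.log n)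
    (hA4 : cellRate γ (cell n) ≤ 1 / 4) :
    P.real {ω | WidthLE (stitchedCI ε v γ (fun i => Y i ω) n)
      (2 * (shift ε (cellRate γ (cell n)) / cellWeight ε v γ (cell n)))}ᶜ ≤ γ / 4 := by
  have hlam := cellWeight_pos (ε := ε) hv hγ hγ₁ (cell n)
  have hA := cellRate_pos hγ hγ₁ (cell n)
  have hvA := mul_cellWeight_rpow hε hv hγ hγ₁ (cell n)
  set j := cell n with hj
  set lam := cellWeight ε v γ j
  set A := cellRate γ j
  -- Each side may fail with probability $\gamma/8$.
  have hc : 0 < 8 / γ := by positivity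
  have h1 := measureReal_influenceSum_shift_ge_le hε hε₁ hν hY hind hlaw hlam.ne'
    (by rw [abs_of_pos hlam]; exact hvA) hA hA4 hc
  have h2 := measureReal_influenceSum_shift_ge_le hε hε₁ hν hY hind hlaw (neg_neg_of_pos hlam).ne
    (by rw [abs_neg, abs_of_pos hlam]; exact hvA) hA hA4 hc
  -- The three copies of $nA$ pay for $\log(8/\gamma)$, for $\log(2/\gamma_j)$ and for
  -- $nA/(1+\epsilon)$. The first is at most the second because $(j+1)^2\ge 4$.
  have hR : n * (-(3 * A)) + Real.log (8 / γ) ≤ -cellRadius ε γ j n := by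
    have h8 : Real.log (8 / γ) ≤ Real.log (2 / cellLevel γ j) := by
      refine Real.log_le_log hc ?_
      rw [cellLevel, div_div_eq_mul_div]
      gcongr
      have : (1 : ℝ) ≤ j := by exact_mod_cast one_le_cell n
      nlinarith
    have hL : Real.log (2 / cellLevel γ j) ≤ n * A := by
      rw [← cellRate_mul_exp, mul_comm]
      gcongr
      exact exp_cell_le hn
    have hp : n * (A / (1 + ε)) ≤ n * A := by
      gcongr
      exact div_le_self hA.le (by linarith)
    unfold cellRadius; linarith
  refine (measureReal_mono ?_).trans ((measureReal_union_le _ _).trans ((add_le_add h1 h2).trans ?_))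
  · intro ω hω
    by_contra hnot
    simp only [Set.mem_union, Set.mem_ofPred_eq, not_or, not_le] at hnot
    refine hω (widthLE_of_influenceSum (μ := ∫ x, x ∂ν) hε hv hγ hγ₁ (hnot.1.trans_le hR) ?_)
    have h3 := hnot.2.trans_le hR
    rw [influenceSum_neg, div_neg, ← sub_eq_add_neg] at h3
    exact neg_lt_neg_iff.1 h3
  · rw [one_div_div]; linarith

/-- The constant in the width bound. -/
noncomputable def widthConst (ε : ℝ) : ℝ := 108 * 32 ^ (1 / ε)

lemma widthConst_pos : 0 < widthConst ε := by unfold widthConst; positivity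

lemma two_mul_shift_div_le (hε : 0 < ε) (hv : 0 < v) (hγ : 0 < γ) (hγ₁ : γ ≤ 1)
    {n : ℕ} (hn : 1 ≤ n) :
    2 * (shift ε (cellRate γ (cell n)) / cellWeight ε v γ (cell n)) ≤
      widthConst ε * v ^ (1 / (1 + ε)) * widthRate γ n ^ (ε / (1 + ε)) := by
  have hlam := cellWeight_pos (ε := ε) hv hγ hγ₁ (cell n)
  have hA := cellRate_pos hγ hγ₁ (cell n)
  have hAB := cellRate_le_widthRate hγ hγ₁ hn
  have hB : 0 < widthRate γ n := by linarith
  have he : ε / (1 + ε) ≤ 1 := by rw [div_le_one (by linarith)]; linarith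
  have h1 : cellRate γ (cell n) ^ (ε / (1 + ε)) ≤ 3 * widthRate γ n ^ (ε / (1 + ε)) := by
    calc cellRate γ (cell n) ^ (ε / (1 + ε)) ≤ (3 * widthRate γ n) ^ (ε / (1 + ε)) := by gcongr
      _ = 3 ^ (ε / (1 + ε)) * widthRate γ n ^ (ε / (1 + ε)) :=
          Real.mul_rpow (by norm_num) hB.le
      _ ≤ 3 * widthRate γ n ^ (ε / (1 + ε)) := by
          gcongr
          exact (Real.rpow_le_rpow_of_exponent_le (by norm_num) he).trans_eq (Real.rpow_one 3)
  calc 2 * (shift ε (cellRate γ (cell n)) / cellWeight ε v γ (cell n))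
      ≤ 2 * (18 * 32 ^ (1 / ε) * cellRate γ (cell n) / cellWeight ε v γ (cell n)) := by
        gcongr; exact shift_le hε hA
    _ = 36 * 32 ^ (1 / ε) * (v ^ (1 / (1 + ε)) * cellRate γ (cell n) ^ (ε / (1 + ε))) := by
        rw [← div_cellWeight_eq hε hv hγ hγ₁]; ring
    _ ≤ 36 * 32 ^ (1 / ε) * (v ^ (1 / (1 + ε)) * (3 * widthRate γ n ^ (ε / (1 + ε)))) := by gcongr
    _ = _ := by unfold widthConst; ring

lemma WidthLE.mono {S : Set ℝ} {w w' : ℝ} (h : WidthLE S w) (hw : w ≤ w') : WidthLE S w' :=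
  fun m hm m' hm' => (h m hm m' hm').trans hw

/-- The width bound for the stitched Catoni sets. -/
lemma measureReal_compl_widthLE_le (hε : 0 < ε) (hε₁ : ε ≤ 1) (hv : 0 < v) {T n : ℕ} (hT : 2 ≤ T)
    (hn : nMin ε T ≤ n) (hγT : γ = 2 / (T : ℝ) ^ 3)
    (hν : HeavyTailed ε v ν) {Y : ℕ → Ω → ℝ} (hY : ∀ i, Measurable (Y i)) (hind : iIndepFun Y P)
    (hlaw : ∀ i < n, P.map (Y i) = ν) {C : ℝ} (hC : widthConst ε ≤ C) :
    P.real {ω | WidthLE (stitchedCI ε v γ (fun i => Y i ω) n)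
      (C * v ^ (1 / (1 + ε)) * widthRate γ n ^ (ε / (1 + ε)))}ᶜ ≤ γ / 4 := by
  subst hγT
  have hγ := level_pos hT
  have hγ₁ : 2 / (T : ℝ) ^ 3 ≤ 1 := (level_le hT).trans (by norm_num)
  have h4 := four_lt_log_of_nMin_le hε hε₁ hT hn
  have h1n : 1 ≤ n := by
    rcases Nat.eq_zero_or_pos n with rfl | h
    · simp at h4; linarith
    · exact h
  have hB : 0 < widthRate (2 / (T : ℝ) ^ 3) n := by
    linarith [cellRate_pos hγ hγ₁ (cell n), cellRate_le_widthRate hγ hγ₁ h1n]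
  refine (measureReal_mono (Set.compl_subset_compl.2 fun ω hω => ?_)).trans
    (measureReal_compl_widthLE_shift_le hε hε₁ hv hγ hγ₁ hν hY hind hlaw (by linarith)
      (cellRate_le_quarter hε hε₁ hT hn))
  refine WidthLE.mono hω ((two_mul_shift_div_le hε hv hγ hγ₁ h1n).trans ?_)
  gcongr

end Width

/-! ### Choice of the constant, detection delay and false alarms. -/

section Detection

variable {ε v γ : ℝ}

/-- The last condition is implicit because the post-change sample size, proportional to $C$, enters
its own width bound through a logarithm. It is solvable since $\log C=o(C)$. -/
lemma exists_detectionConst (ε : ℝ) : ∃ C : ℝ, widthConst ε ≤ C ∧ 272 / ε ≤ C ∧ 4 ≤ C ∧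
    2 * (11 + 16 / ε + 4 * Real.log C) * (2 * widthConst ε) ^ ((1 + ε) / ε) < C := by
  set K := (2 * widthConst ε) ^ ((1 + ε) / ε)
  have hK : 0 < K := Real.rpow_pos_of_pos (mul_pos two_pos widthConst_pos) _
  have hlog : ∀ᶠ C : ℝ in Filter.atTop, ‖Real.log C‖ ≤ 1 / (16 * K) * ‖C‖ :=
    Real.isLittleO_log_id_atTop.bound (by positivity)
  obtain ⟨C, h1, h2, h3, h4, h5⟩ := (hlog.and ((Filter.eventually_ge_atTop (widthConst ε)).and
    ((Filter.eventually_ge_atTop (272 / ε)).and ((Filter.eventually_ge_atTop 4).and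
      (Filter.eventually_gt_atTop (2 * (2 * (11 + 16 / ε) * K))))))).exists
  refine ⟨C, h2, h3, h4, ?_⟩
  rw [Real.norm_eq_abs, Real.norm_eq_abs, abs_of_pos (by linarith : 0 < C)] at h1
  have h6 : Real.log C ≤ 1 / (16 * K) * C := (le_abs_self _).trans h1
  have h7 : 8 * K * Real.log C ≤ C / 2 := by
    calc 8 * K * Real.log C ≤ 8 * K * (1 / (16 * K) * C) := by gcongr
      _ = C / 2 := by field_simp; norm_num
  linarith

/-- A width hypothesis at round `tc ≤ T` keeps the delay scale polynomial in `T`. -/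
lemma delayScale_le_of_widthLE (hε : 0 < ε) (hε₁ : ε ≤ 1) (hv : 0 < v) {T tc : ℕ} (hT : 2 ≤ T)
    (htc : nMin ε T ≤ tc) (htT : tc ≤ T) {δ : ℝ} {x : ℕ → ℝ}
    (h : WidthLE (stitchedCI ε v (2 / (T : ℝ) ^ 3) x tc) (δ / 2)) :
    0 < δ ∧ v ^ (1 / ε) / δ ^ ((1 + ε) / ε) ≤ 3 ^ ((1 + ε) / ε) * T := by
  have hγ := level_pos hT
  have hγ₁ : 2 / (T : ℝ) ^ 3 ≤ 1 := (level_le hT).trans (by norm_num)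
  have h4 := four_lt_log_of_nMin_le hε hε₁ hT htc
  have h1n : 1 ≤ tc := by
    rcases Nat.eq_zero_or_pos tc with rfl | h
    · simp at h4; linarith
    · exact h
  have hT0 : (0 : ℝ) < T := Nat.cast_pos.2 (two_pos.trans_le hT)
  have hA := cellRate_pos hγ hγ₁ (cell tc)
  have hw := le_of_widthLE hε hε₁ hv hγ hγ₁ x h1n h
  set A := cellRate (2 / (T : ℝ) ^ 3) (cell tc) with hAdef
  have hpos : 0 < v ^ (1 / (1 + ε)) * A ^ (ε / (1 + ε)) := by positivity
  have hδ : 0 < δ := by linarith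
  refine ⟨hδ, ?_⟩
  -- Here $Ae^j\ge 3\log T\ge 1$ while $e^j\le t_c\le T$.
  have hAT : 1 ≤ A * T := by
    have h1 : A * Real.exp (cell tc) = Real.log (2 / cellLevel (2 / (T : ℝ) ^ 3) (cell tc)) :=
      cellRate_mul_exp _
    rw [log_two_div_cellLevel hγ, log_two_div_level] at h1
    have h2 : Real.exp (cell tc) ≤ T :=
      (exp_cell_le (by linarith)).trans (by exact_mod_cast htT)
    have h3 : 0 ≤ Real.log ((cell tc : ℝ) + 1) := Real.log_nonneg (by
      linarith [(Nat.cast_nonneg (cell tc) : (0 : ℝ) ≤ cell tc)])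
    have h5 := half_lt_log hT
    nlinarith
  have hpow : v ^ (1 / ε) * A ≤ 3 ^ ((1 + ε) / ε) * δ ^ ((1 + ε) / ε) := by
    have h1 : (v ^ (1 / (1 + ε)) * A ^ (ε / (1 + ε))) ^ ((1 + ε) / ε) ≤
        (3 * δ) ^ ((1 + ε) / ε) :=
      Real.rpow_le_rpow hpos.le (by linarith) (by positivity)
    rw [Real.mul_rpow (by positivity) (by positivity), Real.mul_rpow (by positivity) hδ.le,
      ← Real.rpow_mul hv.le, ← Real.rpow_mul hA.le] at h1
    have e1 : 1 / (1 + ε) * ((1 + ε) / ε) = 1 / ε := by field_simp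
    have e2 : ε / (1 + ε) * ((1 + ε) / ε) = 1 := by field_simp
    rwa [e1, e2, Real.rpow_one] at h1
  rw [div_le_iff₀ (by positivity)]
  calc v ^ (1 / ε) ≤ v ^ (1 / ε) * (A * T) := le_mul_of_one_le_right (by positivity) hAT
    _ = v ^ (1 / ε) * A * T := by ring
    _ ≤ 3 ^ ((1 + ε) / ε) * δ ^ ((1 + ε) / ε) * T := by gcongr
    _ = _ := by ring

/-- After a delay of the claimed order, the width bound is below half of the change. -/
lemma widthRate_lt_half (hε : 0 < ε) (hε₁ : ε ≤ 1) (hv : 0 < v) {T : ℕ} (hT : 2 ≤ T) {δ C : ℝ}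
    (hδ : 0 < δ) (hC1 : 272 / ε ≤ C) (hC4 : 4 ≤ C)
    (hC : 2 * (11 + 16 / ε + 4 * Real.log C) * (2 * widthConst ε) ^ ((1 + ε) / ε) < C)
    (hQT : v ^ (1 / ε) / δ ^ ((1 + ε) / ε) ≤ 3 ^ ((1 + ε) / ε) * T) {n : ℕ}
    (hn : n = ⌊C * max 1 (v ^ (1 / ε) / δ ^ ((1 + ε) / ε)) * Real.log T⌋₊) :
    nMin ε T ≤ n ∧ widthConst ε * v ^ (1 / (1 + ε)) *
      widthRate (2 / (T : ℝ) ^ 3) n ^ (ε / (1 + ε)) < δ / 2 := by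
  have hT0 : (0 : ℝ) < T := Nat.cast_pos.2 (two_pos.trans_le hT)
  have hT1 : (2 : ℝ) ≤ T := by exact_mod_cast hT
  have hl := half_lt_log hT
  have hlT : Real.log T ≤ T := (Real.log_le_sub_one_of_pos hT0).trans (by linarith)
  set q := v ^ (1 / ε) / δ ^ ((1 + ε) / ε) with hq
  have hq0 : 0 < q := by positivity
  set Q := max 1 q with hQ
  have hQ1 : 1 ≤ Q := le_max_left _ _
  have hQq : q ≤ Q := le_max_right _ _
  have hp1 : 1 ≤ (1 + ε) / ε := by rw [one_le_div hε]; linarith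
  have h3 : (1 : ℝ) ≤ 3 ^ ((1 + ε) / ε) := Real.one_le_rpow (by norm_num) (by linarith)
  have hQT' : Q ≤ 3 ^ ((1 + ε) / ε) * T := max_le (by nlinarith) hQT
  -- A value of at least 2 loses at most half of itself when rounded down.
  have hG : 2 ≤ C * Q * Real.log T := by
    calc (2 : ℝ) ≤ 4 * 1 * (69 / 100) := by norm_num
      _ ≤ C * Q * Real.log T := by gcongr
  have hnle : (n : ℝ) ≤ C * Q * Real.log T := hn ▸ Nat.floor_le (by linarith)
  have hnge : C * Q * Real.log T / 2 ≤ n := by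
    have := Nat.lt_floor_add_one (C * Q * Real.log T)
    rw [← hn] at this; linarith
  have hn1 : 1 ≤ n := by
    have : (1 : ℝ) ≤ n := by linarith
    exact_mod_cast this
  have hn0 : (0 : ℝ) < n := by exact_mod_cast hn1
  constructor
  · rw [nMin, Real.log_rpow hT0]
    have h1 : 68 * ((1 + ε) / ε) ≤ C / 2 := by
      have : 68 * ((1 + ε) / ε) ≤ (272 / ε) / 2 := by
        rw [mul_div_assoc', div_div, div_le_div_iff₀ hε (by positivity)]
        nlinarith
      linarith
    calc 68 * ((1 + ε) / ε * Real.log T) = 68 * ((1 + ε) / ε) * Real.log T := by ring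
      _ ≤ C / 2 * Real.log T := by gcongr
      _ ≤ C / 2 * Real.log T * Q := le_mul_of_one_le_right (by positivity) hQ1
      _ = C * Q * Real.log T / 2 := by ring
      _ ≤ n := hnge
  have hlogC : 0 ≤ Real.log C := Real.log_nonneg (by linarith)
  have hlogn : Real.log n ≤ Real.log C + 4 / ε + 2 * Real.log T := by
    have h1 : (n : ℝ) ≤ C * 3 ^ ((1 + ε) / ε) * (T : ℝ) ^ 2 := by
      calc (n : ℝ) ≤ C * (3 ^ ((1 + ε) / ε) * T) * T := hnle.trans (by gcongr)
        _ = _ := by ring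
    have h2 := Real.log_le_log hn0 h1
    rw [Real.log_mul (by positivity) (by positivity), Real.log_mul (by positivity) (by positivity),
      Real.log_pow, Real.log_rpow (by norm_num)] at h2
    have h4 : (1 + ε) / ε * Real.log 3 ≤ 4 / ε := by
      have : Real.log 3 ≤ 2 := by linarith [Real.log_le_sub_one_of_pos (by norm_num : (0 : ℝ) < 3)]
      calc (1 + ε) / ε * Real.log 3 ≤ 2 / ε * 2 :=
            mul_le_mul (by gcongr; linarith) this (Real.log_nonneg (by norm_num)) (by positivity)
        _ = 4 / ε := by ring
    push_cast at h2
    linarith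
  -- The crude bound $\log(2+\log n)\le 1+\log n$ suffices. The terms free of $T$ are multiplied by
  -- $2\log T\ge 1$.
  have hnum : Real.log (2 / (2 / (T : ℝ) ^ 3)) + 2 * Real.log (Real.log (Real.exp 2 * n)) ≤
      (11 + 16 / ε + 4 * Real.log C) * Real.log T := by
    rw [log_two_div_level, log_exp_two_mul hn1]
    have h0 : 0 ≤ Real.log n := Real.log_natCast_nonneg n
    have h1 := Real.log_le_sub_one_of_pos (by linarith : 0 < 2 + Real.log n)
    have h2 : 0 ≤ (2 + 8 / ε + 2 * Real.log C) * (2 * Real.log T - 1) :=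
      mul_nonneg (by positivity) (by linarith)
    have h4 : 8 / ε = 2 * (4 / ε) := by ring
    have h5 : 16 / ε = 4 * (4 / ε) := by ring
    rw [h4] at h2
    rw [h5]
    linarith
  have hB0 : 0 ≤ widthRate (2 / (T : ℝ) ^ 3) n := by
    unfold widthRate
    rw [log_two_div_level, log_exp_two_mul hn1]
    have h0 : 0 ≤ Real.log n := Real.log_natCast_nonneg n
    have h1 : 0 ≤ Real.log (2 + Real.log n) := Real.log_nonneg (by linarith)
    positivity
  have hW := widthConst_pos (ε := ε)
  have hB : widthRate (2 / (T : ℝ) ^ 3) n <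
      (δ / (2 * widthConst ε * v ^ (1 / (1 + ε)))) ^ ((1 + ε) / ε) := by
    -- Solving the width inequality for the rate turns the target into a lower bound on $n$ of order
    -- $q\log T$.
    have hE : (δ / (2 * widthConst ε * v ^ (1 / (1 + ε)))) ^ ((1 + ε) / ε) =
        1 / (q * (2 * widthConst ε) ^ ((1 + ε) / ε)) := by
      rw [Real.div_rpow hδ.le (by positivity), Real.mul_rpow (by positivity) (by positivity),
        ← Real.rpow_mul hv.le, show 1 / (1 + ε) * ((1 + ε) / ε) = 1 / ε by field_simp, hq]
      field_simp
    rw [hE, widthRate, lt_div_iff₀ (by positivity), div_mul_eq_mul_div, div_lt_one hn0]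
    set K := (2 * widthConst ε) ^ ((1 + ε) / ε)
    have hK : 0 < K := by positivity
    calc _ ≤ (11 + 16 / ε + 4 * Real.log C) * Real.log T * (Q * K) := by gcongr
      _ = (2 * (11 + 16 / ε + 4 * Real.log C) * K) * (Q * Real.log T) / 2 := by ring
      _ < C * (Q * Real.log T) / 2 := by gcongr
      _ = C * Q * Real.log T / 2 := by ring
      _ ≤ n := hnge
  have hfin := Real.rpow_lt_rpow hB0 hB (by positivity : 0 < ε / (1 + ε))
  rw [← Real.rpow_mul (by positivity), show (1 + ε) / ε * (ε / (1 + ε)) = 1 by field_simp,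
    Real.rpow_one, lt_div_iff₀ (by positivity)] at hfin
  linarith

variable {CI : (ℕ → ℝ) → ℕ → Set ℝ} {x : ℕ → ℝ}

lemma detectionTime_le {t : ℕ} (h : FCSAlarm CI x t) : detectionTime CI x ≤ t :=
  iInf_le (fun t : {t : ℕ // FCSAlarm CI x t} => ((t : ℕ) : ℕ∞)) ⟨t, h⟩

lemma exists_alarm_of_detectionTime_lt {s : ℕ} (h : detectionTime CI x < s) :
    ∃ t < s, FCSAlarm CI x t := by
  obtain ⟨⟨t, ht⟩, hlt⟩ := iInf_lt_iff.1 h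
  exact ⟨t, by exact_mod_cast hlt, ht⟩

/-- Two narrow confidence sets around distant means share no point. -/
lemma fcsAlarm_of_widthLE {tc n : ℕ} (htc : 1 ≤ tc) (hn : 1 ≤ n) {μ₀ μ₁ w : ℝ}
    (h₀ : μ₀ ∈ CI (fun i => x (1 + i)) tc) (hw₀ : WidthLE (CI (fun i => x (1 + i)) tc) (|μ₁ - μ₀| / 2))
    (h₁ : μ₁ ∈ CI (fun i => x (tc + 1 + i)) n) (hw₁ : WidthLE (CI (fun i => x (tc + 1 + i)) n) w)
    (hw : w < |μ₁ - μ₀| / 2) : FCSAlarm CI x (tc + n) := by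
  rw [FCSAlarm, Set.eq_empty_iff_forall_notMem]
  intro m hm
  have hm₀ := hw₀ m (hm 1 tc le_rfl htc (by omega)) μ₀ h₀
  have hm₁ := hw₁ μ₁ h₁ m (hm (tc + 1) n (by omega) hn (by omega))
  linarith [abs_sub_le μ₁ m μ₀]

variable {Ω : Type*} [MeasurableSpace Ω] {P : Measure Ω}
  {X : ℕ → Ω → ℝ} {P₀ P₁ : Measure ℝ} {tc : ℕ}

lemma IsChangeStream.iIndepFun_shift (hX : IsChangeStream P X P₀ P₁ tc) (a : ℕ) :
    iIndepFun (fun i => X (a + i)) P :=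
  hX.indep.precomp (add_right_injective a)

variable [IsProbabilityMeasure P]

/-- The false alarm probability of the Catoni-FCS-detector. -/
lemma measureReal_detectionTime_lt_le (hε : 0 < ε) (hε₁ : ε ≤ 1) (hv : 0 < v)
    (hγ : 0 < γ) (hγ₁ : γ ≤ 1) (h₀ : HeavyTailed ε v P₀) (hX : IsChangeStream P X P₀ P₁ tc) :
    P.real {ω | catoniDetectionTime ε v γ (fun t => X t ω) < (tc : ℕ∞)} ≤ tc * γ := by
  -- The horizon $t_c+1-a$ ends the run started at $a$ exactly at round $t_c$, so only pre-change
  -- observations enter.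
  refine le_trans (measureReal_mono (s₂ := ⋃ a ∈ Finset.Icc 1 tc, {ω | ∃ n, 1 ≤ n ∧
    n ≤ tc + 1 - a ∧ (∫ x, x ∂P₀) ∉ stitchedCI ε v γ (fun i => X (a + i) ω) n}) ?_
      (measure_ne_top _ _)) ((measureReal_biUnion_finset_le _ _).trans
        ((Finset.sum_le_sum (g := fun _ => γ) fun a ha => ?_).trans ?_))
  · intro ω hω
    obtain ⟨t, htc, ht⟩ := exists_alarm_of_detectionTime_lt hω
    rw [FCSAlarm, Set.eq_empty_iff_forall_notMem] at ht
    have h := ht (∫ x, x ∂P₀)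
    simp only [Set.mem_ofPred_eq, not_forall] at h
    obtain ⟨a, n, ha, hn, hle, hmem⟩ := h
    simp only [Set.mem_iUnion]
    exact ⟨a, Finset.mem_Icc.2 ⟨ha, by omega⟩, n, hn, by omega, hmem⟩
  · rw [Finset.mem_Icc] at ha
    exact measureReal_exists_notMem_stitchedCI_le (Y := fun i => X (a + i)) hε hε₁ hv hγ hγ₁ h₀
      (fun i => hX.measurable _) (hX.iIndepFun_shift a)
      fun i hi => hX.law_pre _ (by omega) (by omega)
  · simp

lemma measureReal_compl_mem_stitchedCI_le (hε : 0 < ε) (hε₁ : ε ≤ 1) (hv : 0 < v)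
    (hγ : 0 < γ) (hγ₁ : γ ≤ 1) {ν : Measure ℝ}
    (hν : HeavyTailed ε v ν) {Y : ℕ → Ω → ℝ} (hY : ∀ i, Measurable (Y i)) (hind : iIndepFun Y P)
    {n : ℕ} (hn : 1 ≤ n) (hlaw : ∀ i < n, P.map (Y i) = ν) :
    P.real {ω | (∫ x, x ∂ν) ∈ stitchedCI ε v γ (fun i => Y i ω) n}ᶜ ≤ γ := by
  refine le_trans (measureReal_mono ?_ (measure_ne_top _ _))
    (measureReal_exists_notMem_stitchedCI_le hε hε₁ hv hγ hγ₁ hν hY hind hlaw)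
  exact fun _ hω => ⟨n, hn, le_rfl, hω⟩

/-- The detection delay of the Catoni-FCS-detector. -/
lemma one_sub_le_measureReal_delay_le (hε : 0 < ε) (hε₁ : ε ≤ 1) (hv : 0 < v) {T : ℕ} (hT : 2 ≤ T)
    (hγT : γ = 2 / (T : ℝ) ^ 3) (h₀ : HeavyTailed ε v P₀) (h₁ : HeavyTailed ε v P₁)
    {δ : ℝ} (hδ : δ = |∫ x, x ∂P₁ - ∫ x, x ∂P₀|) (htc : 1 ≤ tc) (htT : tc ≤ T)
    (hX : IsChangeStream P X P₀ P₁ tc) (hmin : nMin ε T ≤ tc)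
    (hwidth : 1 - γ / 4 ≤ P.real {ω | WidthLE
      (stitchedCI ε v γ (fun i => X (1 + i) ω) tc) (δ / 2)}) {C : ℝ}
    (hC1 : 272 / ε ≤ C) (hC4 : 4 ≤ C)
    (hC : 2 * (11 + 16 / ε + 4 * Real.log C) * (2 * widthConst ε) ^ ((1 + ε) / ε) < C) :
    1 - (5 / 2) * γ ≤ P.real {ω |
      ((catoniDetectionTime ε v γ (fun t => X t ω) - (tc : ℕ∞) : ℕ∞) : ℝ≥0∞) ≤
        ENNReal.ofReal (C * max 1 (v ^ (1 / ε) / δ ^ ((1 + ε) / ε)) * Real.log T)} := by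
  have hγ : 0 < γ := hγT ▸ level_pos hT
  have hγ4 : γ ≤ 1 / 4 := hγT ▸ level_le hT
  have hγ₁ : γ ≤ 1 := by linarith
  set E₀ := {ω | WidthLE (stitchedCI ε v γ (fun i => X (1 + i) ω) tc) (δ / 2)} with hE₀
  -- Passing from a large probability of the event to a small one of its complement does need
  -- measurability.
  have hE₀m : MeasurableSet E₀ :=
    measurableSet_widthLE (Y := fun i => X (1 + i)) hε hv hγ hγ₁ (fun i => hX.measurable _) tc
      (by rw [hδ]; positivity)
  have hE₀c : P.real E₀ᶜ ≤ γ / 4 := by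
    rw [measureReal_compl hE₀m, probReal_univ]; linarith
  -- The lower bound on the width holds for every data sequence, so a single outcome in the event
  -- already bounds the delay scale.
  obtain ⟨ω₀, hω₀⟩ : E₀.Nonempty := by
    rw [Set.nonempty_iff_ne_empty]
    intro h
    rw [h, measureReal_empty] at hwidth
    linarith
  obtain ⟨hδ0, hQ⟩ := delayScale_le_of_widthLE hε hε₁ hv hT hmin htT
    (show WidthLE (stitchedCI ε v (2 / (T : ℝ) ^ 3) (fun i => X (1 + i) ω₀) tc) (δ / 2) from
      hγT ▸ hω₀)
  obtain ⟨n, hn⟩ : ∃ n : ℕ, n =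
    ⌊C * max 1 (v ^ (1 / ε) / δ ^ ((1 + ε) / ε)) * Real.log T⌋₊ := ⟨_, rfl⟩
  obtain ⟨hnmin, hw⟩ := widthRate_lt_half hε hε₁ hv hT hδ0 hC1 hC4 hC hQ hn
  rw [← hγT] at hw
  have hn1 : 1 ≤ n := by
    have h1 := log_le_of_nMin_le hε hε₁ hT hnmin
    have h2 := half_lt_log hT
    have h3 : (0 : ℝ) < n := by linarith
    exact_mod_cast h3
  have hE₁ := measureReal_compl_mem_stitchedCI_le (Y := fun i => X (1 + i)) hε hε₁ hv hγ hγ₁ h₀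
    (fun i => hX.measurable _) (hX.iIndepFun_shift 1) htc
    fun i hi => hX.law_pre _ (by omega) (by omega)
  have hE₂ := measureReal_compl_mem_stitchedCI_le (Y := fun i => X (tc + 1 + i)) hε hε₁ hv hγ hγ₁ h₁
    (fun i => hX.measurable _) (hX.iIndepFun_shift (tc + 1)) hn1
    fun i _ => hX.law_post _ (by omega)
  have hE₃ := measureReal_compl_widthLE_le (Y := fun i => X (tc + 1 + i)) hε hε₁ hv hT hnmin hγT h₁
    (fun i => hX.measurable _) (hX.iIndepFun_shift (tc + 1))
    (fun i _ => hX.law_post _ (by omega)) le_rfl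
  set E₁ := {ω | (∫ x, x ∂P₀) ∈ stitchedCI ε v γ (fun i => X (1 + i) ω) tc}
  set E₂ := {ω | (∫ x, x ∂P₁) ∈ stitchedCI ε v γ (fun i => X (tc + 1 + i) ω) n}
  set E₃ := {ω | WidthLE (stitchedCI ε v γ (fun i => X (tc + 1 + i) ω) n)
    (widthConst ε * v ^ (1 / (1 + ε)) * widthRate γ n ^ (ε / (1 + ε)))}
  apply one_sub_le_measureReal_of_compl
  -- Two coverage failures of cost $\gamma$ and two width failures of cost $\gamma/4$ make up
  -- $\tfrac52\gamma$.
  refine (measureReal_mono (s₂ := (E₀ᶜ ∪ E₁ᶜ) ∪ (E₂ᶜ ∪ E₃ᶜ)) ?_ (measure_ne_top _ _)).trans ?_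
  · intro ω hω
    by_contra hnot
    simp only [Set.mem_union, Set.mem_compl_iff, not_or, not_not] at hnot
    obtain ⟨⟨hω0, hω1⟩, hω2, hω3⟩ := hnot
    apply hω
    have hω0' : WidthLE (stitchedCI ε v γ (fun i => X (1 + i) ω) tc) (δ / 2) := hω0
    rw [hδ] at hω0' hw
    have ht : catoniDetectionTime ε v γ (fun t => X t ω) ≤ (tc + n : ℕ) :=
      detectionTime_le (fcsAlarm_of_widthLE (CI := stitchedCI ε v γ) (x := fun t => X t ω)
        htc hn1 hω1 hω0' hω2 hω3 hw)
    have hsub : catoniDetectionTime ε v γ (fun t => X t ω) - (tc : ℕ∞) ≤ (n : ℕ∞) := by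
      rw [tsub_le_iff_right, add_comm]
      exact_mod_cast ht
    calc ((catoniDetectionTime ε v γ (fun t => X t ω) - (tc : ℕ∞) : ℕ∞) : ℝ≥0∞)
        ≤ ((n : ℕ∞) : ℝ≥0∞) := ENat.toENNReal_le.2 hsub
      _ = ENNReal.ofReal n := by rw [ENNReal.ofReal_natCast]; rfl
      _ ≤ _ := by
          refine ENNReal.ofReal_le_ofReal ?_
          rw [hn]
          refine Nat.floor_le ?_
          have := half_lt_log hT
          positivity
  · have h1 := measureReal_union_le (μ := P) (E₀ᶜ ∪ E₁ᶜ) (E₂ᶜ ∪ E₃ᶜ)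
    have h2 := measureReal_union_le (μ := P) E₀ᶜ E₁ᶜ
    have h3 := measureReal_union_le (μ := P) E₂ᶜ E₃ᶜ
    linarith

lemma mul_level_le {T tc : ℕ} (hT : 2 ≤ T) (htT : tc ≤ T) :
    tc * (2 / (T : ℝ) ^ 3) ≤ 14 / (T : ℝ) := by
  have hT1 : (2 : ℝ) ≤ T := by exact_mod_cast hT
  have htT' : (tc : ℝ) ≤ T := by exact_mod_cast htT
  calc tc * (2 / (T : ℝ) ^ 3) ≤ T * (2 / (T : ℝ) ^ 3) := by gcongr
    _ ≤ 14 / (T : ℝ) := by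
      rw [mul_div_assoc', div_le_div_iff₀ (by positivity) (by positivity)]
      nlinarith [sq_nonneg (T : ℝ)]

end Detection

end CatoniFCS

theorem proposition1 (ε : ℝ) (hε₀ : 0 < ε) (hε₁ : ε ≤ 1) :
    ∃ C : ℝ, 0 < C ∧ ∀ (v : ℝ) (T : ℕ) (γ : ℝ), 0 < v → 2 ≤ T → γ = 2 / (T : ℝ) ^ 3 →
      -- the stitched Catoni sets form a confidence sequence of level `1 - γ`,
      -- and their width obeys the stitched bound
      (∀ (Ω : Type*) [MeasurableSpace Ω] (P : Measure Ω) [IsProbabilityMeasure P]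
          (Y : ℕ → Ω → ℝ) (ν : Measure ℝ),
        CatoniFCS.HeavyTailed ε v ν → CatoniFCS.IsIIDStream P Y ν →
        1 - γ ≤ P.real {ω | ∀ n : ℕ, 1 ≤ n →
            (∫ x, x ∂ν) ∈ CatoniFCS.stitchedCI ε v γ (fun i => Y i ω) n} ∧
        ∀ n : ℕ, CatoniFCS.nMin ε T ≤ n →
          1 - γ / 4 ≤ P.real {ω | CatoniFCS.WidthLE
              (CatoniFCS.stitchedCI ε v γ (fun i => Y i ω) n)
              (C * v ^ (1 / (1 + ε)) *
                ((Real.log (2 / γ) + 2 * Real.log (Real.log (Real.exp 2 * n))) / n)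
                  ^ (ε / (1 + ε)))}) ∧
      -- detection delay and false alarms
      (∀ (Ω : Type*) [MeasurableSpace Ω] (P : Measure Ω) [IsProbabilityMeasure P]
          (X : ℕ → Ω → ℝ) (P₀ P₁ : Measure ℝ) (μ₀ μ₁ δ : ℝ) (tc : ℕ),
        CatoniFCS.HeavyTailed ε v P₀ → CatoniFCS.HeavyTailed ε v P₁ →
        ∫ x, x ∂P₀ = μ₀ → ∫ x, x ∂P₁ = μ₁ → δ = |μ₁ - μ₀| →
        1 ≤ tc → tc ≤ T → CatoniFCS.IsChangeStream P X P₀ P₁ tc →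
        CatoniFCS.nMin ε T ≤ tc →
        1 - γ / 4 ≤ P.real {ω | CatoniFCS.WidthLE
            (CatoniFCS.stitchedCI ε v γ (fun i => X (1 + i) ω) tc) (δ / 2)} →
        1 - 14 / (T : ℝ) ≤ P.real {ω |
            ((CatoniFCS.catoniDetectionTime ε v γ (fun t => X t ω) - (tc : ℕ∞) : ℕ∞) : ℝ≥0∞) ≤
              ENNReal.ofReal (C * max 1 (v ^ (1 / ε) / δ ^ ((1 + ε) / ε)) * Real.log T)} ∧
        P.real {ω | CatoniFCS.catoniDetectionTime ε v γ (fun t => X t ω) < (tc : ℕ∞)} ≤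
          14 / (T : ℝ)) := by
  obtain ⟨C, hCw, hC1, hC4, hC⟩ := CatoniFCS.exists_detectionConst ε
  refine ⟨C, by linarith, fun v T γ hv hT hγT => ⟨?_, ?_⟩⟩
  · intro Ω _ P _ Y ν hν hY
    have hγ : 0 < γ := hγT ▸ CatoniFCS.level_pos hT
    have hγ₁ : γ ≤ 1 := (hγT ▸ CatoniFCS.level_le hT : γ ≤ 1 / 4).trans (by norm_num)
    exact ⟨CatoniFCS.one_sub_le_measureReal_forall_mem_stitchedCI hε₀ hε₁ hv hγ hγ₁ hν hY,
      fun n hn => CatoniFCS.one_sub_le_measureReal_of_compl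
        (CatoniFCS.measureReal_compl_widthLE_le hε₀ hε₁ hv hT hn hγT hν hY.measurable hY.indep
          (fun i _ => hY.law i) hCw)⟩
  · intro Ω _ P _ X P₀ P₁ μ₀ μ₁ δ tc h₀ h₁ hμ₀ hμ₁ hδ htc htT hX hmin hwidth
    subst hμ₀ hμ₁
    have hγ : 0 < γ := hγT ▸ CatoniFCS.level_pos hT
    have hγ₁ : γ ≤ 1 := (hγT ▸ CatoniFCS.level_le hT : γ ≤ 1 / 4).trans (by norm_num)
    constructor
    · refine le_trans ?_ (CatoniFCS.one_sub_le_measureReal_delay_le hε₀ hε₁ hv hT hγT h₀ h₁ hδ htc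
        htT hX hmin hwidth hC1 hC4 hC)
      have hT1 : (2 : ℝ) ≤ T := by exact_mod_cast hT
      have h5 : 5 / 2 * γ ≤ 14 / (T : ℝ) := by
        rw [hγT, mul_div_assoc', div_le_div_iff₀ (by positivity) (by positivity)]
        nlinarith [sq_nonneg (T : ℝ)]
      linarith
    · refine (CatoniFCS.measureReal_detectionTime_lt_le hε₀ hε₁ hv hγ hγ₁ h₀ hX).trans ?_
      rw [hγT]
      exact CatoniFCS.mul_level_le hT htT
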